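/- Let $\pi:A\to M$ be a smooth real vector bundle of finite rank $n\ge 1$ over a smooth manifold $M$, with dual bundle $\pi^*:A^*\to M$ and space of smooth sections $\Gamma(A)$. A function on the manifold $A^*$ is called linear if it is smooth and linear on every fibre (equivalently, it is $\tilde\mu$ for some $\mu\in\Gamma(A)$, where $\tilde\mu(\alpha)=\alpha(\mu(x))$ for $\alpha\in A^*_x$), and basic if it is of the form $\bar f\circ\pi^*$ with $\bar f\in C^\infty(M,\mathbb R)$. A Jacobi structure on a manifold $N$ is a pair $(\Lambda,E)$ of a 2-vector and a vector field on $N$ with $[\Lambda,\Lambda]_{SN}=2E\wedge\Lambda$ and $[E,\Lambda]_{SN}=0$, where the sign of the Schouten-Nijenhuis bracket is such that $[\Lambda,\Lambda]_{SN}(df,dg,dh)=2\bigl(\Lambda(d(\Lambda(df,dg)),dh)+\Lambda(d(\Lambda(dg,dh)),df)+\Lambda(d(\Lambda(dh,df)),dg)\bigr)$ and $[E,\Lambda]_{SN}=\mathcal L_E\Lambda$. Its Jacobi bracket is $\{f,g\}=\Lambda(df,dg)+fE(g)-gE(f)$. Let $(\Lambda,E)$ be a Jacobi structure on $A^*$ such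 that (C1) the Jacobi bracket of two linear functions is linear; (C2) the Jacobi bracket of a linear function and the constant function $1$ is basic. Then there are a Lie algebroid structure $([\![\,,]\!],\rho)$ on $\pi:A\to M$ and a 1-cocycle $\phi\in\Gamma(A^*)$ for it, i.e. $\phi([\![\mu,\eta]\!])=\rho(\mu)(\phi(\eta))-\rho(\eta)(\phi(\mu))$ for all $\mu,\eta\in\Gamma(A)$, such that $$\Lambda=\Lambda_{(A^*,\phi)}:=\Lambda_{A^*}+\Delta\wedge\phi^v,\qquad E=E_{(A^*,\phi)}:=-\phi^v .$$ Here $\Delta$ is the Liouville vector field of $A^*$, $\phi^v$ is the vertical lift of $\phi$, $(X\wedge Y)(\alpha,\beta)=\alpha(X)\beta(Y)-\alpha(Y)\beta(X)$, and $\Lambda_{A^*}$ is the 2-vector given, in the coordinates $(x^l,\mu_j=\tilde e_j)$ of $A^*$ defined by local coordinates $(x^l)$ of $M$ and a local frame $(e_i)$ of $A$ with $[\![e_i,e_j]\!]=\sum_k c_{ij}^k e_k$ and $\rho(e_i)=\sum_l\rho_i^l\,\partial/\partial x^l$, by $$\Lambda_{A^*}=\sum_{i<j}\sum_k c_{ij}^k\mu_k\frac{\partial}{\partial\mu_i}\wedge\frac{\partial}{\partial\mu_j}+\sum_{i,l}\rho_i^l\frac{\partial}{\partial\mu_i}\wedge\frac{\partial}{\partial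 x^l}.$$ -/

import Mathlib

open Bundle Manifold
open scoped ContDiff Manifold Topology

noncomputable section

/-! ### Jacobi structures on a manifold -/

section JacobiStructures

variable {E : Type*} [NormedAddCommGroup E] [NormedSpace ℝ E] {H : Type*} [TopologicalSpace H]
  (J : ModelWithCorners ℝ E H) {N : Type*} [TopologicalSpace N] [ChartedSpace H N]

/-- Elements of `Λ²(T_p N)`, `N` finite-dimensional, are regarded as bilinear forms on `T_p^* N`
(those that occur are alternating). -/
abbrev TwoVectorAt (p : N) : Type _ :=
  (TangentSpace J p →L[ℝ] ℝ) →ₗ[ℝ] (TangentSpace J p →L[ℝ] ℝ) →ₗ[ℝ] ℝ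

/-- The 2-vector `X ∧ Y`, `(X ∧ Y)(α, β) = α(X) β(Y) - α(Y) β(X)`. -/
def wedge {p : N} (X Y : TangentSpace J p) : TwoVectorAt J p :=
  LinearMap.mk₂ ℝ (fun α β => α X * β Y - α Y * β X)
    (fun _ _ _ => by simp only [add_apply]; ring)
    (fun _ _ _ => by simp only [smul_apply, smul_eq_mul]; ring)
    (fun _ _ _ => by simp only [add_apply]; ring)
    (fun _ _ _ => by simp only [smul_apply, smul_eq_mul]; ring)

variable (N) in
/-- Smooth 2-vectors (bivector fields) on `N`. Smoothness means that `Λ(df, dg)` is smooth for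
all smooth functions `f`, `g`; this says that the components of `Λ` in charts are smooth. -/
structure BivectorField where
  toFun : ∀ p : N, TwoVectorAt J p
  alternating : ∀ (p : N) (α : TangentSpace J p →L[ℝ] ℝ), toFun p α α = 0
  smooth : ∀ f g : N → ℝ, ContMDiff J 𝓘(ℝ, ℝ) ∞ f → ContMDiff J 𝓘(ℝ, ℝ) ∞ g →
    ContMDiff J 𝓘(ℝ, ℝ) ∞ (fun p => toFun p (mvfderiv J f p) (mvfderiv J g p))

variable {J}

/-- The function `Λ(df, dg)`. -/
def BivectorField.onFun (P : BivectorField J N) (f g : N → ℝ) : N → ℝ :=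
  fun p => P.toFun p (mvfderiv J f p) (mvfderiv J g p)

/-- The value `[P, Q]_SN(df, dg, dh)` of the Schouten-Nijenhuis bracket of two 2-vectors on exact
1-forms; these values determine the 3-vector `[P, Q]_SN`. The sign is that of the convention
`[X₁ ∧ ⋯ ∧ Xₖ, Y₁ ∧ ⋯ ∧ Yₗ] = (-1)^(k+1) ∑ (-1)^(i+j) [Xᵢ, Yⱼ] ∧ X₁ ∧ ⋯ X̂ᵢ ⋯ ∧ Xₖ ∧ Y₁ ∧ ⋯ Ŷⱼ ⋯ ∧ Yₗ`,
the one for which the Jacobi bracket of a Jacobi structure satisfies the Jacobi identity. -/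
def schoutenBivector (P Q : BivectorField J N) (f g h : N → ℝ) : N → ℝ :=
  P.onFun (Q.onFun f g) h + P.onFun (Q.onFun g h) f + P.onFun (Q.onFun h f) g
    + (Q.onFun (P.onFun f g) h + Q.onFun (P.onFun g h) f + Q.onFun (P.onFun h f) g)

variable [IsManifold J ∞ N]

/-- The function `X(f)`. -/
def applyField (X : Cₛ^∞⟮J; E, (TangentSpace J : N → Type _)⟯) (f : N → ℝ) : N → ℝ :=
  fun p => mvfderiv J f p (X p)

/-- The value `[X, P]_SN(df, dg) = (L_X P)(df, dg)` of the Schouten-Nijenhuis bracket of a vector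
field and a 2-vector on exact 1-forms; these values determine the 2-vector `[X, P]_SN`. -/
def schoutenField (X : Cₛ^∞⟮J; E, (TangentSpace J : N → Type _)⟯) (P : BivectorField J N)
    (f g : N → ℝ) : N → ℝ :=
  applyField X (P.onFun f g) - P.onFun (applyField X f) g - P.onFun f (applyField X g)

/-- The value `(X ∧ P)(df, dg, dh)` of the 3-vector `X ∧ P`. -/
def wedgeField (X : Cₛ^∞⟮J; E, (TangentSpace J : N → Type _)⟯) (P : BivectorField J N)
    (f g h : N → ℝ) : N → ℝ :=
  applyField X f * P.onFun g h + applyField X g * P.onFun h f + applyField X h * P.onFun f g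

variable (J N) in
/-- Jacobi structures `(Λ, E)`: `[Λ, Λ]_SN = 2 E ∧ Λ` and `[E, Λ]_SN = 0`. -/
structure JacobiStructure where
  bivector : BivectorField J N
  field : Cₛ^∞⟮J; E, (TangentSpace J : N → Type _)⟯
  schouten_bivector : ∀ f g h : N → ℝ, ContMDiff J 𝓘(ℝ, ℝ) ∞ f → ContMDiff J 𝓘(ℝ, ℝ) ∞ g →
    ContMDiff J 𝓘(ℝ, ℝ) ∞ h →
    schoutenBivector bivector bivector f g h = 2 • wedgeField field bivector f g h
  schouten_field : ∀ f g : N → ℝ, ContMDiff J 𝓘(ℝ, ℝ) ∞ f → ContMDiff J 𝓘(ℝ, ℝ) ∞ g →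
    schoutenField field bivector f g = 0

/-- The Jacobi bracket `{f, g} = Λ(df, dg) + f E(g) - g E(f)`. -/
def JacobiStructure.bracket (S : JacobiStructure J N) (f g : N → ℝ) : N → ℝ :=
  S.bivector.onFun f g + f * applyField S.field g - g * applyField S.field f

end JacobiStructures

/-! ### Lie algebroids and the dual bundle -/

section LieAlgebroids

variable (E : Type*) [NormedAddCommGroup E] [NormedSpace ℝ E]
  {M : Type*} [TopologicalSpace M] [ChartedSpace E M]
  (F : Type*) [NormedAddCommGroup F] [NormedSpace ℝ F]
  (A : M → Type*) [TopologicalSpace (TotalSpace F A)] [∀ x, AddCommGroup (A x)]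
  [∀ x, Module ℝ (A x)] [∀ x, TopologicalSpace (A x)] [FiberBundle F A] [VectorBundle ℝ F A]

/-- The space `Γ(A)` of smooth sections of `A → M`. -/
abbrev Sections : Type _ := Cₛ^∞⟮𝓘(ℝ, E); F, A⟯

/-- The space `Γ(A^*)` of smooth sections of the dual bundle. -/
abbrev DualSections : Type _ := Cₛ^∞⟮𝓘(ℝ, E); F →L[ℝ] ℝ, fun x : M => A x →L[ℝ] ℝ⟯

/-- The total space of the dual bundle `A^* → M`. -/
abbrev DualTotal : Type _ := TotalSpace (F →L[ℝ] ℝ) (fun x : M => A x →L[ℝ] ℝ)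

/-- The model with corners of the manifold `A^*`. -/
abbrev dualModel : ModelWithCorners ℝ (E × (F →L[ℝ] ℝ)) (ModelProd E (F →L[ℝ] ℝ)) :=
  𝓘(ℝ, E).prod 𝓘(ℝ, F →L[ℝ] ℝ)

variable {E F A}

/-- The section `f η` for a smooth function `f`. -/
def smulSection (f : M → ℝ) (hf : ContMDiff 𝓘(ℝ, E) 𝓘(ℝ, ℝ) ∞ f) (η : Sections E F A) :
    Sections E F A :=
  ⟨fun x => f x • η x, hf.smul_section η.contMDiff⟩

variable (E) in
/-- Linear functions on `A^*`: smooth functions that are linear on each fibre. -/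
def IsLinearFunction (h : DualTotal F A → ℝ) : Prop :=
  ContMDiff (dualModel E F) 𝓘(ℝ, ℝ) ∞ h ∧
    ∀ x : M, IsLinearMap ℝ (fun α : A x →L[ℝ] ℝ => h ⟨x, α⟩)

variable (E) in
/-- Basic functions on `A^*`: those of the form `f ∘ π^*` with `f` smooth on `M`. -/
def IsBasicFunction (h : DualTotal F A → ℝ) : Prop :=
  ∃ f : M → ℝ, ContMDiff 𝓘(ℝ, E) 𝓘(ℝ, ℝ) ∞ f ∧ ∀ p : DualTotal F A, h p = f p.proj

variable [IsManifold 𝓘(ℝ, E) ∞ M]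

variable (E F A) in
/-- Lie algebroid structures on `A → M`. The anchor is a smooth section of `Hom(A, TM)`. -/
structure LieAlgebroid where
  bracket : Sections E F A →ₗ[ℝ] Sections E F A →ₗ[ℝ] Sections E F A
  bracket_self : ∀ μ, bracket μ μ = 0
  jacobi : ∀ μ η ζ, bracket μ (bracket η ζ) + bracket η (bracket ζ μ)
    + bracket ζ (bracket μ η) = 0
  anchor : Cₛ^∞⟮𝓘(ℝ, E); F →L[ℝ] E, fun x : M => A x →L[ℝ] TangentSpace 𝓘(ℝ, E) x⟯
  anchor_bracket : ∀ (μ η : Sections E F A) (x : M), anchor x (bracket μ η x) =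
    VectorField.mlieBracket 𝓘(ℝ, E) (fun y => anchor y (μ y)) (fun y => anchor y (η y)) x
  leibniz : ∀ (f : M → ℝ) (hf : ContMDiff 𝓘(ℝ, E) 𝓘(ℝ, ℝ) ∞ f) (μ η : Sections E F A) (x : M),
    bracket μ (smulSection f hf η) x =
      f x • bracket μ η x + mvfderiv 𝓘(ℝ, E) f x (anchor x (μ x)) • η x

/-- `φ ∈ Γ(A^*)` is a 1-cocycle: `φ[μ, η] = ρ(μ)(φ(η)) - ρ(η)(φ(μ))`. -/
def LieAlgebroid.IsCocycle (L : LieAlgebroid E F A) (φ : DualSections E F A) : Prop :=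
  ∀ (μ η : Sections E F A) (x : M), φ x (L.bracket μ η x) =
    mvfderiv 𝓘(ℝ, E) (fun y => φ y (η y)) x (L.anchor x (μ x))
      - mvfderiv 𝓘(ℝ, E) (fun y => φ y (μ y)) x (L.anchor x (η x))

/-! ### The Jacobi structure on the dual bundle of a Lie algebroid with a 1-cocycle -/

variable (E) in
/-- The vertical tangent vector at `p = (x, α)` given by `β ∈ A_x^*`: the velocity at `t = 0` of
the curve `t ↦ (x, α + t β)`. -/
def verticalVector (p : DualTotal F A) (β : A p.proj →L[ℝ] ℝ) :
    TangentSpace (dualModel E F) p :=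
  mfderiv 𝓘(ℝ, ℝ) (dualModel E F)
    (fun t : ℝ => (⟨p.proj, p.snd + t • β⟩ : DualTotal F A)) 0 (1 : ℝ)

variable (E) in
/-- The Liouville vector field `Δ` of `A^*`. -/
def liouville (p : DualTotal F A) : TangentSpace (dualModel E F) p :=
  verticalVector E p p.snd

/-- The vertical lift `φ^v` of `φ ∈ Γ(A^*)`. -/
def verticalLift (φ : DualSections E F A) (p : DualTotal F A) : TangentSpace (dualModel E F) p :=
  verticalVector E p (φ p.proj)

variable [FiniteDimensional ℝ E] [FiniteDimensional ℝ F] [T2Space M]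
  [ContMDiffVectorBundle ∞ F A 𝓘(ℝ, E)]

variable (E F A) in
/-- Near each point `x`, the members of the local frame of `A` given by the trivialization at `x`
and a basis of the model fibre are restrictions of global sections. -/
theorem exists_section_eq_localFrame (x : M) (i : Fin (Module.finrank ℝ F)) :
    ∃ s : Sections E F A, ∀ᶠ y in 𝓝 x,
      s y = (trivializationAt F A x).localFrame (Module.finBasis ℝ F) i y := by
  obtain ⟨f, -, hf⟩ := (SmoothBumpFunction.nhds_basis_tsupport (I := 𝓘(ℝ, E)) x).mem_iff.1
    ((trivializationAt F A x).open_baseSet.mem_nhds (mem_baseSet_trivializationAt F A x))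
  refine ⟨⟨_, ContMDiffOn.smul_section_of_tsupport f.contMDiff.contMDiffOn
    (trivializationAt F A x).open_baseSet hf
    ((trivializationAt F A x).contMDiffOn_localFrame_baseSet ∞ (Module.finBasis ℝ F) i)⟩, ?_⟩
  filter_upwards [f.eventuallyEq_one] with y hy
  simp [hy]

variable (E F A) in
/-- Global sections `e₁, …, eₙ` of `A` which near `x` are the local frame given by the
trivialization at `x`. Brackets of local sections at `x` are computed with such extensions. -/
def frame (x : M) (i : Fin (Module.finrank ℝ F)) : Sections E F A :=
  (exists_section_eq_localFrame E F A x i).choose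

/-- The structure functions `c_{ij}^k(x)`: `[e_i, e_j] = ∑ₖ c_{ij}^k e_k`. -/
def LieAlgebroid.structureFunction (L : LieAlgebroid E F A) (x : M)
    (i j k : Fin (Module.finrank ℝ F)) : ℝ :=
  ((trivializationAt F A x).basisAt (Module.finBasis ℝ F)
    (mem_baseSet_trivializationAt F A x)).repr (L.bracket (frame E F A x i) (frame E F A x j) x) k

/-- The components `ρ_i^l(x)` of the anchor: `ρ(e_i) = ∑ₗ ρ_i^l ∂/∂x^l`, where `x^l` are the
coordinates of the chart at `x`. -/
def LieAlgebroid.anchorComponent (L : LieAlgebroid E F A) (x : M)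
    (i : Fin (Module.finrank ℝ F)) (l : Fin (Module.finrank ℝ E)) : ℝ :=
  (Module.finBasis ℝ E).repr (L.anchor x (frame E F A x i x)) l

variable (E) in
/-- The vector `∂/∂x^l` at `p ∈ A^*` of the fibred coordinates `(x^l, μ_j)` given by the chart
and the trivialization at `π^*(p)`. The tangent space of `A^*` at `p` is the model space
`E × F^*`, by means of the chart of `A^*` at `p`, which is built from these two. -/
def partialX (p : DualTotal F A) (l : Fin (Module.finrank ℝ E)) :
    TangentSpace (dualModel E F) p :=
  ((Module.finBasis ℝ E l, 0) : E × (F →L[ℝ] ℝ))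

variable (E) in
/-- The vector `∂/∂μ_i` at `p ∈ A^*` of the same fibred coordinates. -/
def partialMu (p : DualTotal F A) (i : Fin (Module.finrank ℝ F)) :
    TangentSpace (dualModel E F) p :=
  ((0, LinearMap.toContinuousLinearMap ((Module.finBasis ℝ F).coord i)) : E × (F →L[ℝ] ℝ))

/-- The 2-vector `Λ_{A^*}` at `p ∈ A^*`:
`∑_{i<j} ∑ₖ c_{ij}^k μ_k ∂/∂μ_i ∧ ∂/∂μ_j + ∑_{i,l} ρ_i^l ∂/∂μ_i ∧ ∂/∂x^l`, with
`μ_k(p) = p(e_k)`. -/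
def LieAlgebroid.linearPoisson (L : LieAlgebroid E F A) (p : DualTotal F A) :
    TwoVectorAt (dualModel E F) p :=
  (∑ i, ∑ j ∈ Finset.Ioi i, ∑ k,
      (L.structureFunction p.proj i j k * p.snd (frame E F A p.proj k p.proj)) •
        wedge (dualModel E F) (partialMu E p i) (partialMu E p j))
    + ∑ i, ∑ l, L.anchorComponent p.proj i l •
        wedge (dualModel E F) (partialMu E p i) (partialX E p l)

/-- The 2-vector `Λ_{(A^*, φ)} = Λ_{A^*} + Δ ∧ φ^v`. -/
def LieAlgebroid.dualBivector (L : LieAlgebroid E F A) (φ : DualSections E F A)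
    (p : DualTotal F A) : TwoVectorAt (dualModel E F) p :=
  L.linearPoisson p + wedge (dualModel E F) (liouville E p) (verticalLift φ p)

/-- The vector field `E_{(A^*, φ)} = -φ^v`. -/
def dualField (φ : DualSections E F A) (p : DualTotal F A) : TangentSpace (dualModel E F) p :=
  -verticalLift φ p

end LieAlgebroids

end

/-!
The Jacobi bracket of two linear functions is the linear function of a section, which defines the
bracket of `Γ(A)`. Comparing the Leibniz rule of the Jacobi bracket with the linearity of brackets
along the fibres shows that `E(f ∘ π^*)` and `Λ(d(f ∘ π^*), d(g ∘ π^*))` vanish and that `E(μ̃)` and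
`Λ(dμ̃, d(f ∘ π^*))` are basic; the last two functions are `-φ(μ)` and `ρ(μ)(f)`. Hence
`{μ̃, f ∘ π^*} = D_μ(f) ∘ π^*` with `D_μ = ρ(μ) + φ(μ)`, and the Jacobi identity becomes
`D_[μ, η] = [D_μ, D_η]`. Its value on the function `1` is the cocycle condition; what remains says
that `ρ` is compatible with the brackets. Differentials of linear and of basic functions span the
cotangent spaces of `A^*`, so that `Λ` and `E` are determined by these formulas.
-/

noncomputable section

/-! ### The calculus of Jacobi brackets -/

section JacobiCalculus

variable {E : Type*} [NormedAddCommGroup E] [NormedSpace ℝ E] {H : Type*} [TopologicalSpace H]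
  {J : ModelWithCorners ℝ E H} {N : Type*} [TopologicalSpace N] [ChartedSpace H N]
  {f g h : N → ℝ}

namespace BivectorField

variable (P : BivectorField J N)

theorem toFun_swap (p : N) (α β : TangentSpace J p →L[ℝ] ℝ) :
    P.toFun p α β = -P.toFun p β α := by
  have h := P.alternating p (α + β)
  simp only [map_add, LinearMap.add_apply, P.alternating] at h
  linarith

theorem onFun_swap (f g : N → ℝ) : P.onFun f g = -P.onFun g f :=
  funext fun p => P.toFun_swap p _ _

theorem onFun_self (f : N → ℝ) : P.onFun f f = 0 :=
  funext fun p => P.alternating p _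

theorem onFun_const_right (c : ℝ) : P.onFun f (fun _ => c) = 0 := by
  ext p
  simp [onFun, mvfderiv_const]

theorem onFun_add_right (hg : MDifferentiable J 𝓘(ℝ, ℝ) g) (hh : MDifferentiable J 𝓘(ℝ, ℝ) h) :
    P.onFun f (g + h) = P.onFun f g + P.onFun f h := by
  ext p
  simp [onFun, mvfderiv_add (hg p) (hh p)]

theorem onFun_sub_right (hg : MDifferentiable J 𝓘(ℝ, ℝ) g) (hh : MDifferentiable J 𝓘(ℝ, ℝ) h) :
    P.onFun f (g - h) = P.onFun f g - P.onFun f h := by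
  ext p
  simp [onFun, mvfderiv_sub (hg p) (hh p)]

theorem onFun_mul_right (hg : MDifferentiable J 𝓘(ℝ, ℝ) g) (hh : MDifferentiable J 𝓘(ℝ, ℝ) h) :
    P.onFun f (g * h) = g * P.onFun f h + h * P.onFun f g := by
  ext p
  simp [onFun, mvfderiv_mul (hg p) (hh p)]

theorem onFun_mul_left (hg : MDifferentiable J 𝓘(ℝ, ℝ) g) (hh : MDifferentiable J 𝓘(ℝ, ℝ) h) :
    P.onFun (g * h) f = g * P.onFun h f + h * P.onFun g f := by
  rw [P.onFun_swap, P.onFun_mul_right hg hh, P.onFun_swap f h, P.onFun_swap f g]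
  ring

end BivectorField

variable [IsManifold J ∞ N]

section Field

variable (X : Cₛ^∞⟮J; E, (TangentSpace J : N → Type _)⟯)

theorem contMDiff_applyField (hf : ContMDiff J 𝓘(ℝ, ℝ) ∞ f) :
    ContMDiff J 𝓘(ℝ, ℝ) ∞ (applyField X f) :=
  (contMDiff_snd_tangentBundle_modelSpace ℝ 𝓘(ℝ, ℝ)).comp
    ((hf.contMDiff_tangentMap (m := ∞) (by simp)).comp X.contMDiff)

theorem applyField_const (c : ℝ) : applyField X (fun _ => c) = 0 := by
  ext p
  simp [applyField, mvfderiv_const]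

theorem applyField_add (hf : MDifferentiable J 𝓘(ℝ, ℝ) f) (hg : MDifferentiable J 𝓘(ℝ, ℝ) g) :
    applyField X (f + g) = applyField X f + applyField X g := by
  ext p
  simp [applyField, mvfderiv_add (hf p) (hg p)]

theorem applyField_sub (hf : MDifferentiable J 𝓘(ℝ, ℝ) f) (hg : MDifferentiable J 𝓘(ℝ, ℝ) g) :
    applyField X (f - g) = applyField X f - applyField X g := by
  ext p
  simp [applyField, mvfderiv_sub (hf p) (hg p)]

theorem applyField_mul (hf : MDifferentiable J 𝓘(ℝ, ℝ) f) (hg : MDifferentiable J 𝓘(ℝ, ℝ) g) :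
    applyField X (f * g) = f * applyField X g + g * applyField X f := by
  ext p
  simp [applyField, mvfderiv_mul (hf p) (hg p)]

end Field

namespace JacobiStructure

variable (S : JacobiStructure J N)

theorem bracket_swap (f g : N → ℝ) : S.bracket f g = -S.bracket g f := by
  rw [bracket, bracket, S.bivector.onFun_swap]
  ring

theorem bracket_self (f : N → ℝ) : S.bracket f f = 0 := by
  rw [bracket, S.bivector.onFun_self]
  ring

theorem bracket_one_right (f : N → ℝ) : S.bracket f 1 = -applyField S.field f := by
  rw [bracket, Pi.one_def, S.bivector.onFun_const_right, applyField_const, ← Pi.one_def]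
  ring

theorem bracket_add_right (hg : MDifferentiable J 𝓘(ℝ, ℝ) g) (hh : MDifferentiable J 𝓘(ℝ, ℝ) h) :
    S.bracket f (g + h) = S.bracket f g + S.bracket f h := by
  simp only [bracket, S.bivector.onFun_add_right hg hh, applyField_add _ hg hh]
  ring

theorem bracket_mul_right (hg : MDifferentiable J 𝓘(ℝ, ℝ) g) (hh : MDifferentiable J 𝓘(ℝ, ℝ) h) :
    S.bracket f (g * h) =
      g * S.bracket f h + h * S.bivector.onFun f g + f * h * applyField S.field g := by
  simp only [bracket, S.bivector.onFun_mul_right hg hh, applyField_mul _ hg hh]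
  ring

theorem bracket_smul_right (c : ℝ) (hg : MDifferentiable J 𝓘(ℝ, ℝ) g) :
    S.bracket f (c • g) = c • S.bracket f g := by
  have smul_eq (k : N → ℝ) : c • k = (fun _ => c) * k := rfl
  rw [smul_eq, smul_eq, S.bracket_mul_right mdifferentiable_const hg,
    S.bivector.onFun_const_right, applyField_const]
  ring

theorem bracket_neg_right (hg : MDifferentiable J 𝓘(ℝ, ℝ) g) :
    S.bracket f (-g) = -S.bracket f g := by
  simpa using S.bracket_smul_right (f := f) (-1) hg

theorem bracket_bracket (f : N → ℝ) (hg : ContMDiff J 𝓘(ℝ, ℝ) ∞ g)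
    (hh : ContMDiff J 𝓘(ℝ, ℝ) ∞ h) :
    S.bracket f (S.bracket g h) =
      S.bivector.onFun f (S.bivector.onFun g h)
        + (g * S.bivector.onFun f (applyField S.field h)
          + applyField S.field h * S.bivector.onFun f g)
        - (h * S.bivector.onFun f (applyField S.field g)
          + applyField S.field g * S.bivector.onFun f h)
        + f * (applyField S.field (S.bivector.onFun g h)
          + g * applyField S.field (applyField S.field h)
          - h * applyField S.field (applyField S.field g))
        - S.bracket g h * applyField S.field f := by
  have hP : MDifferentiable J 𝓘(ℝ, ℝ) (S.bivector.onFun g h) :=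
    (S.bivector.smooth g h hg hh).mdifferentiable (by simp)
  have hEg := (contMDiff_applyField S.field hg).mdifferentiable (by simp)
  have hEh := (contMDiff_applyField S.field hh).mdifferentiable (by simp)
  replace hg := hg.mdifferentiable (by simp)
  replace hh := hh.mdifferentiable (by simp)
  have hgEh : MDifferentiable J 𝓘(ℝ, ℝ) (g * applyField S.field h) := hg.mul hEh
  have hhEg : MDifferentiable J 𝓘(ℝ, ℝ) (h * applyField S.field g) := hh.mul hEg
  have hPgEh : MDifferentiable J 𝓘(ℝ, ℝ) (S.bivector.onFun g h + g * applyField S.field h) :=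
    hP.add hgEh
  rw [bracket, bracket, S.bivector.onFun_sub_right hPgEh hhEg, S.bivector.onFun_add_right hP hgEh,
    S.bivector.onFun_mul_right hg hEh, S.bivector.onFun_mul_right hh hEg,
    applyField_sub _ hPgEh hhEg, applyField_add _ hP hgEh, applyField_mul _ hg hEh,
    applyField_mul _ hh hEg]
  ring

theorem jacobi_identity (hf : ContMDiff J 𝓘(ℝ, ℝ) ∞ f) (hg : ContMDiff J 𝓘(ℝ, ℝ) ∞ g)
    (hh : ContMDiff J 𝓘(ℝ, ℝ) ∞ h) :
    S.bracket f (S.bracket g h) + S.bracket g (S.bracket h f)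
      + S.bracket h (S.bracket f g) = 0 := by
  have schouten := S.schouten_bivector f g h hf hg hh
  have lie_fg := S.schouten_field f g hf hg
  have lie_gh := S.schouten_field g h hg hh
  have lie_hf := S.schouten_field h f hh hf
  have swap := S.bivector.onFun_swap
  rw [schoutenBivector, wedgeField] at schouten
  rw [schoutenField, swap (applyField S.field f) g] at lie_fg
  rw [schoutenField, swap (applyField S.field g) h] at lie_gh
  rw [schoutenField, swap (applyField S.field h) f] at lie_hf
  rw [S.bracket_bracket f hg hh, S.bracket_bracket g hh hf, S.bracket_bracket h hf hg,
    swap f (S.bivector.onFun g h), swap g (S.bivector.onFun h f), swap h (S.bivector.onFun f g),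
    bracket, bracket, bracket, swap f h, swap g f, swap h g]
  ext p
  have schouten := congrFun schouten p
  have lie_fg := congrFun lie_fg p
  have lie_gh := congrFun lie_gh p
  have lie_hf := congrFun lie_hf p
  simp only [Pi.add_apply, Pi.mul_apply, Pi.sub_apply, Pi.neg_apply, Pi.smul_apply,
    Pi.zero_apply, nsmul_eq_mul, Nat.cast_ofNat] at schouten lie_fg lie_gh lie_hf ⊢
  linear_combination (-1 / 2) * schouten + h p * lie_fg + f p * lie_gh + g p * lie_hf

end JacobiStructure

end JacobiCalculus

/-! ### Smooth maps into finite-dimensional spaces -/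

section FiniteDimensional

variable {E : Type*} [NormedAddCommGroup E] [NormedSpace ℝ E] {H : Type*} [TopologicalSpace H]
  {J : ModelWithCorners ℝ E H} {N : Type*} [TopologicalSpace N] [ChartedSpace H N]
  {F : Type*} [NormedAddCommGroup F] [NormedSpace ℝ F] [FiniteDimensional ℝ F]
  {G : Type*} [NormedAddCommGroup G] [NormedSpace ℝ G] {n : WithTop ℕ∞} {x : N}

theorem contMDiffAt_of_forall_dual {f : N → F}
    (h : ∀ ℓ : F →L[ℝ] ℝ, ContMDiffAt J 𝓘(ℝ, ℝ) n (fun y => ℓ (f y)) x) :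
    ContMDiffAt J 𝓘(ℝ, F) n f x := by
  let e := (Module.finBasis ℝ F).equivFunL
  have he : ContMDiffAt J 𝓘(ℝ, Fin (Module.finrank ℝ F) → ℝ) n (fun y => e (f y)) x :=
    contMDiffAt_pi_space.2 fun i => h ((ContinuousLinearMap.proj i).comp e.toContinuousLinearMap)
  simpa only [Function.comp_def, e.symm_apply_apply] using
    e.symm.contDiff.contMDiff.contMDiffAt.comp x he

theorem contMDiffAt_clm_of_basis {ι : Type*} [Finite ι] (b : Module.Basis ι ℝ F)
    {f : N → F →L[ℝ] G} (h : ∀ i, ContMDiffAt J 𝓘(ℝ, G) n (fun y => f y (b i)) x) :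
    ContMDiffAt J 𝓘(ℝ, F →L[ℝ] G) n f x := by
  have := Fintype.ofFinite ι
  let single (i : ι) : G →L[ℝ] F →L[ℝ] G :=
    ContinuousLinearMap.smulRightL ℝ F G (LinearMap.toContinuousLinearMap (b.coord i))
  have hf (y : N) : f y = ∑ i, single i (f y (b i)) :=
    ContinuousLinearMap.coe_injective <| b.ext fun j => by
      classical simp [single, Finsupp.single_apply]
  rw [funext hf]
  exact contMDiffAt_finsetSum fun i _ => (single i).contMDiff.contMDiffAt.comp x (h i)

end FiniteDimensional

theorem eventually_mem_baseSet {B : Type*} [TopologicalSpace B] (F : Type*) [TopologicalSpace F]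
    (A : B → Type*) [TopologicalSpace (TotalSpace F A)] [∀ x, TopologicalSpace (A x)]
    [FiberBundle F A] (x : B) : ∀ᶠ y in 𝓝 x, y ∈ (trivializationAt F A x).baseSet :=
  (trivializationAt F A x).open_baseSet.mem_nhds (mem_baseSet_trivializationAt F A x)

/-! ### Global extensions of local functions and sections -/

section Extension

variable {E : Type*} [NormedAddCommGroup E] [NormedSpace ℝ E] [FiniteDimensional ℝ E]
  {M : Type*} [TopologicalSpace M] [T2Space M] [ChartedSpace E M] [IsManifold 𝓘(ℝ, E) ∞ M]

theorem exists_contMDiff_eventuallyEq {f : M → ℝ} {x : M} {U : Set M} (hU : IsOpen U)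
    (hx : x ∈ U) (hf : ContMDiffOn 𝓘(ℝ, E) 𝓘(ℝ, ℝ) ∞ f U) :
    ∃ g : M → ℝ, ContMDiff 𝓘(ℝ, E) 𝓘(ℝ, ℝ) ∞ g ∧ g =ᶠ[𝓝 x] f := by
  obtain ⟨ψ, -, hψ⟩ := (SmoothBumpFunction.nhds_basis_tsupport (I := 𝓘(ℝ, E)) x).mem_iff.1
    (hU.mem_nhds hx)
  refine ⟨fun y => ψ y • f y, contMDiff_of_tsupport fun y hy => ?_, ?_⟩
  · have hyU : y ∈ U := hψ (tsupport_smul_subset_left _ _ hy)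
    exact ψ.contMDiff.contMDiffAt.smul ((hf y hyU).contMDiffAt (hU.mem_nhds hyU))
  · filter_upwards [ψ.eventuallyEq_one] with y hy
    simp [hy]

theorem exists_contMDiff_eventuallyEq_chart (x : M) (ℓ : E →L[ℝ] ℝ) :
    ∃ g : M → ℝ, ContMDiff 𝓘(ℝ, E) 𝓘(ℝ, ℝ) ∞ g ∧ g =ᶠ[𝓝 x] fun y => ℓ (extChartAt 𝓘(ℝ, E) x y) :=
  exists_contMDiff_eventuallyEq (isOpen_extChartAt_source (I := 𝓘(ℝ, E)) x)
    (mem_extChartAt_source x)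
    (ℓ.contMDiff.comp_contMDiffOn (contMDiffOn_extChartAt.mono (by simp)))

variable {F : Type*} [NormedAddCommGroup F] [NormedSpace ℝ F] [FiniteDimensional ℝ F]
  {A : M → Type*} [TopologicalSpace (TotalSpace F A)] [∀ x, AddCommGroup (A x)]
  [∀ x, Module ℝ (A x)] [∀ x, TopologicalSpace (A x)] [FiberBundle F A] [VectorBundle ℝ F A]
  [ContMDiffVectorBundle ∞ F A 𝓘(ℝ, E)]

theorem eventually_frame_eq_symmL (x : M) (i : Fin (Module.finrank ℝ F)) :
    ∀ᶠ y in 𝓝 x, frame E F A x i y =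
      (trivializationAt F A x).symmL ℝ y (Module.finBasis ℝ F i) := by
  filter_upwards [(exists_section_eq_localFrame E F A x i).choose_spec,
    eventually_mem_baseSet F A x] with y hframe hy
  rw [frame, hframe, Trivialization.localFrame_apply_of_mem_baseSet _ _ hy, Trivialization.basisAt]
  simp [hy]

theorem frame_self (x : M) (i : Fin (Module.finrank ℝ F)) :
    frame E F A x i x = (trivializationAt F A x).basisAt (Module.finBasis ℝ F)
      (mem_baseSet_trivializationAt F A x) i := by
  rw [frame, (exists_section_eq_localFrame E F A x i).choose_spec.self_of_nhds,
    Trivialization.localFrame_apply_of_mem_baseSet]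

variable (E) in
theorem exists_section_eventuallyEq_symmL (x : M) (a : F) :
    ∃ μ : Sections E F A, ∀ᶠ y in 𝓝 x, μ y = (trivializationAt F A x).symmL ℝ y a := by
  set b := Module.finBasis ℝ F
  refine ⟨∑ i, b.repr a i • frame E F A x i, ?_⟩
  filter_upwards [Filter.eventually_all.2
    fun i => eventually_frame_eq_symmL (E := E) (F := F) (A := A) x i] with y hy
  rw [← ContMDiffSection.coeAddHom_apply, map_sum, Finset.sum_apply]
  conv_rhs => rw [← b.sum_repr a, map_sum]
  simp only [ContMDiffSection.coeAddHom_apply, ContMDiffSection.coe_smul, Pi.smul_apply, hy,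
    map_smul, b]

variable (E F) in
theorem exists_section_apply_eq {x : M} (a : A x) : ∃ μ : Sections E F A, μ x = a := by
  obtain ⟨μ, hμ⟩ := exists_section_eventuallyEq_symmL (A := A) E x
    ((trivializationAt F A x).continuousLinearMapAt ℝ x a)
  exact ⟨μ, hμ.self_of_nhds.trans (Trivialization.symmL_continuousLinearMapAt _
    (mem_baseSet_trivializationAt F A x) a)⟩

theorem contMDiff_hom_of_forall {G : Type*} [NormedAddCommGroup G] [NormedSpace ℝ G]
    {B : M → Type*} [TopologicalSpace (TotalSpace G B)] [∀ x, AddCommGroup (B x)]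
    [∀ x, Module ℝ (B x)] [∀ x, TopologicalSpace (B x)] [∀ x, IsTopologicalAddGroup (B x)]
    [∀ x, ContinuousSMul ℝ (B x)] [FiberBundle G B] [VectorBundle ℝ G B]
    (T : ∀ x, A x →L[ℝ] B x)
    (h : ∀ μ : Sections E F A, ContMDiff 𝓘(ℝ, E) (𝓘(ℝ, E).prod 𝓘(ℝ, G)) ∞
      (fun x => TotalSpace.mk' G x (T x (μ x)))) :
    ContMDiff 𝓘(ℝ, E) (𝓘(ℝ, E).prod 𝓘(ℝ, F →L[ℝ] G)) ∞
      (fun x => TotalSpace.mk' (F →L[ℝ] G) (E := fun x => A x →L[ℝ] B x) x (T x)) := by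
  intro x
  refine (contMDiffAt_hom_bundle _).2
    ⟨contMDiffAt_id, contMDiffAt_clm_of_basis (Module.finBasis ℝ F) fun i => ?_⟩
  refine ((contMDiffAt_section x).1 (h (frame E F A x i) x)).congr_of_eventuallyEq ?_
  filter_upwards [eventually_frame_eq_symmL (E := E) (A := A) x i, eventually_mem_baseSet F A x,
    eventually_mem_baseSet G B x] with y hframe hA hB
  rw [ContinuousLinearMap.inCoordinates_eq hA hB, hframe]
  simp [hA, Trivialization.continuousLinearEquivAt_apply]

end Extension

/-! ### Differentials in charts -/

section Charts

variable {E : Type*} [NormedAddCommGroup E] [NormedSpace ℝ E] {H : Type*} [TopologicalSpace H]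
  {J : ModelWithCorners ℝ E H} {N : Type*} [TopologicalSpace N] [ChartedSpace H N]
  [IsManifold J 1 N] {g : N → ℝ} {p : N}

theorem mvfderiv_eq_of_hasFDerivAt {Ψ : E → ℝ} {Ψ' : E →L[ℝ] ℝ}
    (hΨ : HasFDerivAt Ψ Ψ' (extChartAt J p p)) (hg : g =ᶠ[𝓝 p] Ψ ∘ extChartAt J p) :
    mvfderiv J g p = Ψ' := by
  ext v
  change mfderiv J 𝓘(ℝ, ℝ) g p v = _
  rw [hg.mfderiv_eq, mfderiv_comp p hΨ.differentiableAt.mdifferentiableAt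
    (mdifferentiableAt_extChartAt (mem_chart_source H p)), mfderiv_extChartAt_self,
    mfderiv_eq_fderiv, hΨ.fderiv]
  rfl

theorem mvfderiv_eq_of_eventuallyEq {ℓ : E →L[ℝ] ℝ} (hg : g =ᶠ[𝓝 p] ℓ ∘ extChartAt J p) :
    mvfderiv J g p = ℓ :=
  mvfderiv_eq_of_hasFDerivAt ℓ.hasFDerivAt hg

end Charts

/-! ### Vector fields as derivations -/

section VectorFields

variable {E : Type*} [NormedAddCommGroup E] [NormedSpace ℝ E]
  {M : Type*} [TopologicalSpace M] [ChartedSpace E M]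

theorem mvfderiv_eq_comp_trivializationAt [IsManifold 𝓘(ℝ, E) 1 M] {g : M → ℝ} {x y : M}
    (ℓ : E →L[ℝ] ℝ)
    (hg : g =ᶠ[𝓝 y] fun z => ℓ (extChartAt 𝓘(ℝ, E) x z)) (hy : y ∈ (chartAt E x).source) :
    mvfderiv 𝓘(ℝ, E) g y = ℓ ∘L (trivializationAt E (TangentSpace 𝓘(ℝ, E) : M → Type _)
      x).continuousLinearMapAt ℝ y := by
  rw [TangentBundle.continuousLinearMapAt_trivializationAt hy]
  ext v
  change mfderiv 𝓘(ℝ, E) 𝓘(ℝ, ℝ) g y v = _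
  rw [hg.mfderiv_eq]
  change mfderiv 𝓘(ℝ, E) 𝓘(ℝ, ℝ) (ℓ ∘ extChartAt 𝓘(ℝ, E) x) y v = _
  rw [mfderiv_comp y ℓ.mdifferentiableAt (mdifferentiableAt_extChartAt hy), ℓ.mfderiv_eq]
  rfl

variable [IsManifold 𝓘(ℝ, E) ∞ M] [FiniteDimensional ℝ E] [T2Space M]

theorem exists_contMDiff_mvfderiv_eq (x : M) (ℓ : E →L[ℝ] ℝ) :
    ∃ f : M → ℝ, ContMDiff 𝓘(ℝ, E) 𝓘(ℝ, ℝ) ∞ f ∧ mvfderiv 𝓘(ℝ, E) f x = ℓ := by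
  obtain ⟨f, hf, hfx⟩ := exists_contMDiff_eventuallyEq_chart x ℓ
  exact ⟨f, hf, mvfderiv_eq_of_eventuallyEq hfx⟩

theorem tangentVector_ext {x : M} {v w : TangentSpace 𝓘(ℝ, E) x}
    (h : ∀ f : M → ℝ, ContMDiff 𝓘(ℝ, E) 𝓘(ℝ, ℝ) ∞ f →
      mvfderiv 𝓘(ℝ, E) f x v = mvfderiv 𝓘(ℝ, E) f x w) : v = w := by
  refine (SeparatingDual.eq_iff_forall_dual_eq (R := ℝ) (V := E)).2 fun ℓ => ?_
  obtain ⟨f, hf, rfl⟩ := exists_contMDiff_mvfderiv_eq x ℓ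
  exact h f hf

theorem contMDiff_vectorField_of_forall {X : ∀ x : M, TangentSpace 𝓘(ℝ, E) x}
    (h : ∀ f : M → ℝ, ContMDiff 𝓘(ℝ, E) 𝓘(ℝ, ℝ) ∞ f →
      ContMDiff 𝓘(ℝ, E) 𝓘(ℝ, ℝ) ∞ (fun x => mvfderiv 𝓘(ℝ, E) f x (X x))) :
    ContMDiff 𝓘(ℝ, E) (𝓘(ℝ, E).prod 𝓘(ℝ, E)) ∞
      (fun x => TotalSpace.mk' E x (X x) : M → TangentBundle 𝓘(ℝ, E) M) := by
  intro x
  refine (contMDiffAt_section x).2 (contMDiffAt_of_forall_dual fun ℓ => ?_)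
  obtain ⟨g, hg, hgx⟩ := exists_contMDiff_eventuallyEq_chart x ℓ
  refine (h g hg x).congr_of_eventuallyEq ?_
  filter_upwards [hgx.eventuallyEq_nhds, (chartAt E x).open_source.mem_nhds
    (mem_chart_source E x)] with y hy hyx
  rw [mvfderiv_eq_comp_trivializationAt ℓ hy hyx, ContinuousLinearMap.comp_apply,
    Trivialization.continuousLinearMapAt_apply, Trivialization.coe_linearMapAt_of_mem _ hyx]

end VectorFields

section LieBracket

variable {E : Type*} [NormedAddCommGroup E] [NormedSpace ℝ E]
  {M : Type*} [TopologicalSpace M] [ChartedSpace E M] [IsManifold 𝓘(ℝ, E) ∞ M]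

variable (E M) in
/-- The space of smooth vector fields on `M`, as sections of the tangent bundle. -/
abbrev SmoothVectorField : Type _ := Sections E E (TangentSpace 𝓘(ℝ, E) : M → Type _)

namespace SmoothVectorField

theorem mdifferentiableAt (U : SmoothVectorField E M) (x : M) :
    MDifferentiableAt 𝓘(ℝ, E) (𝓘(ℝ, E).prod 𝓘(ℝ, E))
      (fun y => TotalSpace.mk' E y (U y) : M → TangentBundle 𝓘(ℝ, E) M) x :=
  (U.contMDiff x).mdifferentiableAt (by simp)

section Complete

variable [CompleteSpace E]

/-- The Lie bracket of smooth vector fields, as a smooth vector field. -/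
def lieBracket (U V : SmoothVectorField E M) : SmoothVectorField E M where
  toFun := VectorField.mlieBracket 𝓘(ℝ, E) U V
  contMDiff_toFun x := by
    have : IsManifold 𝓘(ℝ, E) (minSmoothness ℝ 2) M := by
      simpa using inferInstanceAs (IsManifold 𝓘(ℝ, E) 2 M)
    have : IsManifold 𝓘(ℝ, E) ((⊤ : ℕ∞) + 1 : WithTop ℕ∞) M := by simpa
    exact ContMDiffAt.mlieBracket_vectorField (m := ⊤) (n := ⊤) (U.contMDiff x) (V.contMDiff x)
      (by simp)

theorem lieBracket_add_right (U V W : SmoothVectorField E M) :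
    lieBracket U (V + W) = lieBracket U V + lieBracket U W := by
  have : IsManifold 𝓘(ℝ, E) (minSmoothness ℝ 2) M := by
    simpa using inferInstanceAs (IsManifold 𝓘(ℝ, E) 2 M)
  ext x
  exact VectorField.mlieBracket_add_right (mdifferentiableAt V x) (mdifferentiableAt W x)

theorem lieBracket_smulSection {f : M → ℝ} (hf : ContMDiff 𝓘(ℝ, E) 𝓘(ℝ, ℝ) ∞ f)
    (U V : SmoothVectorField E M) :
    lieBracket U (smulSection f hf V) =
      smulSection (applyField U f) (contMDiff_applyField U hf) V
        + smulSection f hf (lieBracket U V) := by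
  have : IsManifold 𝓘(ℝ, E) (minSmoothness ℝ 2) M := by
    simpa using inferInstanceAs (IsManifold 𝓘(ℝ, E) 2 M)
  ext x
  exact VectorField.mlieBracket_smul_right ((hf x).mdifferentiableAt (by simp))
    (mdifferentiableAt V x)

theorem lieBracket_lieBracket (U V W : SmoothVectorField E M) :
    lieBracket U (lieBracket V W) =
      lieBracket (lieBracket U V) W + lieBracket V (lieBracket U W) := by
  have : IsManifold 𝓘(ℝ, E) (minSmoothness ℝ 3) M := by
    simpa using inferInstanceAs (IsManifold 𝓘(ℝ, E) 3 M)
  have hC (Z : SmoothVectorField E M) (y : M) :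
      ContMDiffAt 𝓘(ℝ, E) (𝓘(ℝ, E).prod 𝓘(ℝ, E)) (minSmoothness ℝ 2)
        (fun x => TotalSpace.mk' E x (Z x) : M → TangentBundle 𝓘(ℝ, E) M) y :=
    (Z.contMDiff y).of_le (by simpa using ENat.LEInfty.out)
  ext x
  exact VectorField.leibniz_identity_mlieBracket_apply (hC U x) (hC V x) (hC W x)

end Complete

variable [FiniteDimensional ℝ E] [T2Space M]

-- The Leibniz identity for `U, V, f W` reduces to that for `U, V, W` up to the claim times `W`.
theorem applyField_lieBracket (U V : SmoothVectorField E M) {f : M → ℝ}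
    (hf : ContMDiff 𝓘(ℝ, E) 𝓘(ℝ, ℝ) ∞ f) :
    applyField (lieBracket U V) f =
      applyField U (applyField V f) - applyField V (applyField U f) := by
  ext x
  rcases subsingleton_or_nontrivial E with hE | hE
  · have eq_zero (v : TangentSpace 𝓘(ℝ, E) x) : v = 0 := hE.elim (α := E) v 0
    simp [applyField, eq_zero (U x), eq_zero (V x), eq_zero (lieBracket U V x)]
  obtain ⟨w, hw⟩ := exists_ne (0 : E)
  obtain ⟨W, rfl⟩ := exists_section_apply_eq E E (A := (TangentSpace 𝓘(ℝ, E) : M → Type _))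
    (x := x) w
  have leibniz := congrArg (· x) (lieBracket_lieBracket U V W)
  have leibniz_smul := congrArg (· x) (lieBracket_lieBracket U V (smulSection f hf W))
  simp only [lieBracket_smulSection, lieBracket_add_right] at leibniz_smul
  simp only [ContMDiffSection.coe_add, Pi.add_apply, smulSection, ContMDiffSection.coeFn_mk]
    at leibniz leibniz_smul
  rw [leibniz] at leibniz_smul
  have smul_W : applyField (lieBracket U V) f x • W x =
      (applyField U (applyField V f) x - applyField V (applyField U f) x) • W x := by
    linear_combination (norm := module) (-1 : ℝ) • leibniz_smul
  exact smul_left_injective ℝ hw smul_W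

end SmoothVectorField

end LieBracket

/-! ### The dual bundle -/

section Bidual

variable (V : Type*) [NormedAddCommGroup V] [NormedSpace ℝ V] [FiniteDimensional ℝ V]

/-- A finite-dimensional space as its bidual, formed with the topological dual, as in the fibres
of `A^*` and in the cotangent spaces. -/
def bidualEquiv : V ≃ₗ[ℝ] (V →L[ℝ] ℝ) →ₗ[ℝ] ℝ :=
  Module.evalEquiv ℝ V ≪≫ₗ LinearMap.toContinuousLinearMap.symm.dualMap

variable {V}

theorem apply_bidualEquiv_symm (H : (V →L[ℝ] ℝ) →ₗ[ℝ] ℝ) (ℓ : V →L[ℝ] ℝ) :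
    ℓ ((bidualEquiv V).symm H) = H ℓ :=
  DFunLike.congr_fun ((bidualEquiv V).apply_symm_apply H) ℓ

end Bidual

section DualBundle

variable {E : Type*} [NormedAddCommGroup E] [NormedSpace ℝ E]
  {M : Type*} [TopologicalSpace M] [ChartedSpace E M]
  {F : Type*} [NormedAddCommGroup F] [NormedSpace ℝ F]
  {A : M → Type*} [TopologicalSpace (TotalSpace F A)] [∀ x, AddCommGroup (A x)]
  [∀ x, Module ℝ (A x)] [∀ x, TopologicalSpace (A x)] [FiberBundle F A] [VectorBundle ℝ F A]

variable (F) in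
/-- The identification of the fibre `A x` with the model fibre given by the trivialization
at `x`. -/
def fiberCoord (x : M) : A x ≃L[ℝ] F :=
  (trivializationAt F A x).continuousLinearEquivAt ℝ x (mem_baseSet_trivializationAt F A x)

/-- The linear function `μ̃` on `A^*` of a section `μ`. -/
def sectionFunction : Sections E F A →ₗ[ℝ] DualTotal F A → ℝ where
  toFun μ p := p.snd (μ p.proj)
  map_add' μ η := funext fun p => map_add p.snd (μ p.proj) (η p.proj)
  map_smul' c μ := funext fun p => map_smul p.snd c (μ p.proj)

theorem sectionFunction_apply (μ : Sections E F A) (p : DualTotal F A) :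
    sectionFunction μ p = p.snd (μ p.proj) := rfl

theorem sectionFunction_injective :
    Function.Injective (sectionFunction : Sections E F A → DualTotal F A → ℝ) := fun _ _ h =>
  ContMDiffSection.ext fun x => (fiberCoord F x).injective <|
    (SeparatingDual.eq_iff_forall_dual_eq (R := ℝ)).2 fun ℓ =>
      congrFun h ⟨x, ℓ ∘L (fiberCoord (A := A) F x).toContinuousLinearMap⟩

theorem sectionFunction_smulSection {f : M → ℝ} (hf : ContMDiff 𝓘(ℝ, E) 𝓘(ℝ, ℝ) ∞ f)
    (η : Sections E F A) :
    sectionFunction (smulSection f hf η) = (f ∘ TotalSpace.proj) * sectionFunction η :=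
  funext fun p => map_smul p.snd (f p.proj) (η p.proj)

theorem contMDiff_sectionFunction (μ : Sections E F A) :
    ContMDiff (dualModel E F) 𝓘(ℝ, ℝ) ∞ (sectionFunction μ) := by
  have h := ContMDiff.clm_bundle_apply (IB := 𝓘(ℝ, E)) (IM := dualModel E F) (F₁ := F) (F₂ := ℝ)
    (E₁ := A) (E₂ := Bundle.Trivial M ℝ) (n := ∞) (b := fun p : DualTotal F A => p.proj)
    (ϕ := fun p => p.snd) (v := fun p => μ p.proj) contMDiff_id
    (μ.contMDiff.comp (contMDiff_proj _))
  exact fun p => (contMDiffAt_totalSpace.1 (h p)).2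

theorem isLinearFunction_sectionFunction (μ : Sections E F A) :
    IsLinearFunction E (sectionFunction μ) :=
  ⟨contMDiff_sectionFunction μ, fun _ => ⟨fun _ _ => rfl, fun _ _ => rfl⟩⟩

theorem contMDiff_comp_proj {f : M → ℝ} (hf : ContMDiff 𝓘(ℝ, E) 𝓘(ℝ, ℝ) ∞ f) :
    ContMDiff (dualModel E F) 𝓘(ℝ, ℝ) ∞ (f ∘ TotalSpace.proj : DualTotal F A → ℝ) :=
  hf.comp (contMDiff_proj _)

/-! ### Vertical vectors -/

theorem contMDiff_fiber_line (x : M) (α β : A x →L[ℝ] ℝ) :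
    ContMDiff 𝓘(ℝ, ℝ) (dualModel E F) ∞ (fun t : ℝ => (⟨x, α + t • β⟩ : DualTotal F A)) := by
  let e := (trivializationAt (F →L[ℝ] ℝ) (fun x : M => A x →L[ℝ] ℝ) x).linearEquivAt ℝ x
    (mem_baseSet_trivializationAt _ _ x)
  refine fun t => contMDiffAt_totalSpace.2 ⟨contMDiffAt_const, ?_⟩
  change ContMDiffAt _ _ _ (fun t : ℝ => e (α + t • β)) t
  simp only [map_add, map_smul]
  exact contMDiffAt_const.add (contMDiffAt_id.smul contMDiffAt_const)

theorem mvfderiv_verticalVector {g : DualTotal F A → ℝ}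
    (hg : ContMDiff (dualModel E F) 𝓘(ℝ, ℝ) ∞ g) (p : DualTotal F A) (β : A p.proj →L[ℝ] ℝ) :
    mvfderiv (dualModel E F) g p (verticalVector E p β) =
      deriv (fun t : ℝ => g ⟨p.proj, p.snd + t • β⟩) 0 := by
  have line_zero : (⟨p.proj, p.snd + (0 : ℝ) • β⟩ : DualTotal F A) = p := by simp
  refine (mvfderiv_comp_apply_of_eq 0 (hg.mdifferentiableAt (by simp))
    ((contMDiff_fiber_line p.proj p.snd β).mdifferentiableAt (by simp)) line_zero
    (1 : ℝ)).symm.trans ?_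
  change mfderiv 𝓘(ℝ, ℝ) 𝓘(ℝ, ℝ) _ 0 (1 : ℝ) = _
  rw [mfderiv_eq_fderiv]
  rfl

theorem mvfderiv_comp_proj_verticalVector {f : M → ℝ} (hf : ContMDiff 𝓘(ℝ, E) 𝓘(ℝ, ℝ) ∞ f)
    (p : DualTotal F A) (β : A p.proj →L[ℝ] ℝ) :
    mvfderiv (dualModel E F) (f ∘ TotalSpace.proj) p (verticalVector E p β) = 0 := by
  simp [mvfderiv_verticalVector (contMDiff_comp_proj hf)]

theorem mvfderiv_sectionFunction_verticalVector (μ : Sections E F A)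
    (p : DualTotal F A) (β : A p.proj →L[ℝ] ℝ) :
    mvfderiv (dualModel E F) (sectionFunction μ) p (verticalVector E p β) = β (μ p.proj) := by
  rw [mvfderiv_verticalVector (contMDiff_sectionFunction μ)]
  exact (((hasDerivAt_mul_const (β (μ p.proj))).const_add (p.snd (μ p.proj)))).deriv

end DualBundle

/-! ### Cotangent spaces of the dual bundle -/

section Charts

variable {E : Type*} [NormedAddCommGroup E] [NormedSpace ℝ E]
  {M : Type*} [TopologicalSpace M] [ChartedSpace E M]
  {F : Type*} [NormedAddCommGroup F] [NormedSpace ℝ F]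
  {A : M → Type*} [TopologicalSpace (TotalSpace F A)] [∀ x, AddCommGroup (A x)]
  [∀ x, Module ℝ (A x)] [∀ x, TopologicalSpace (A x)] [FiberBundle F A] [VectorBundle ℝ F A]

theorem trivializationAt_dual_apply {x : M} {p : DualTotal F A}
    (hp : p.proj ∈ (trivializationAt F A x).baseSet) (a : F) :
    (trivializationAt (F →L[ℝ] ℝ) (fun x : M => A x →L[ℝ] ℝ) x p).2 a =
      p.snd ((trivializationAt F A x).symmL ℝ p.proj a) := by
  rw [hom_trivializationAt_apply, ContinuousLinearMap.inCoordinates_eq hp (by simp)]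
  simp [hp]

theorem extChartAt_dual_apply (p q : DualTotal F A) :
    extChartAt (dualModel E F) p q = (extChartAt 𝓘(ℝ, E) p.proj q.proj,
      (trivializationAt (F →L[ℝ] ℝ) (fun x : M => A x →L[ℝ] ℝ) p.proj q).2) := by
  rw [FiberBundle.extChartAt]
  rfl

theorem extChartAt_dual_zero (x : M) :
    extChartAt (dualModel E F) (⟨x, 0⟩ : DualTotal F A) ⟨x, 0⟩ = (extChartAt 𝓘(ℝ, E) x x, 0) := by
  rw [extChartAt_dual_apply]
  congr 1
  ext a
  exact trivializationAt_dual_apply (p := ⟨x, 0⟩) (mem_baseSet_trivializationAt F A x) a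

theorem eventually_proj {p : DualTotal F A} {P : M → Prop} (h : ∀ᶠ y in 𝓝 p.proj, P y) :
    ∀ᶠ q : DualTotal F A in 𝓝 p, P q.proj :=
  (FiberBundle.continuous_proj (F →L[ℝ] ℝ) (fun x : M => A x →L[ℝ] ℝ)).continuousAt h

variable (E) in
/-- The covector `(v, β) ↦ ℓ v` at `p ∈ A^*`, in the coordinates given by the chart at `p`. -/
def baseCovector (p : DualTotal F A) :
    (E →L[ℝ] ℝ) →ₗ[ℝ] TangentSpace (dualModel E F) p →L[ℝ] ℝ where
  toFun ℓ := ℓ ∘L ContinuousLinearMap.fst ℝ E (F →L[ℝ] ℝ)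
  map_add' _ _ := rfl
  map_smul' _ _ := rfl

variable (E) in
/-- The covector `(v, β) ↦ β a` at `p ∈ A^*`, in the coordinates given by the chart at `p`. -/
def fiberCovector (p : DualTotal F A) : F →ₗ[ℝ] TangentSpace (dualModel E F) p →L[ℝ] ℝ where
  toFun a := ContinuousLinearMap.apply ℝ ℝ a ∘L ContinuousLinearMap.snd ℝ E (F →L[ℝ] ℝ)
  map_add' a b := by ext w; exact map_add w.2 a b
  map_smul' c a := by ext w; exact map_smul w.2 c a

theorem exists_eq_baseCovector_add_fiberCovector [FiniteDimensional ℝ F] (p : DualTotal F A)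
    (ξ : TangentSpace (dualModel E F) p →L[ℝ] ℝ) :
    ∃ ℓ a, ξ = baseCovector E p ℓ + fiberCovector E p a := by
  let ξ' : E × (F →L[ℝ] ℝ) →L[ℝ] ℝ := ξ
  refine ⟨ξ' ∘L ContinuousLinearMap.inl ℝ E _, (bidualEquiv F).symm
    (ξ' ∘L ContinuousLinearMap.inr ℝ E _ : (F →L[ℝ] ℝ) →L[ℝ] ℝ), ?_⟩
  refine ContinuousLinearMap.ext fun w : E × (F →L[ℝ] ℝ) => ?_
  change ξ' w = ξ' (w.1, 0) + w.2 _
  rw [apply_bidualEquiv_symm]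
  change ξ' w = ξ' (w.1, 0) + ξ' (0, w.2)
  rw [← map_add]
  simp

theorem differentiableAt_comp_extChartAt_symm {G : Type*} [NormedAddCommGroup G] [NormedSpace ℝ G]
    {f : M → G} {x : M} (hf : ContMDiffAt 𝓘(ℝ, E) 𝓘(ℝ, G) ∞ f x) :
    DifferentiableAt ℝ (f ∘ (extChartAt 𝓘(ℝ, E) x).symm) (extChartAt 𝓘(ℝ, E) x x) :=
  ((contMDiffAt_iff.1 hf).2.differentiableWithinAt (by simp)).differentiableAt (by simp)

variable (E) in
theorem eventually_comp_extChartAt_symm {G : Type*} (f : M → G) (x : M) :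
    f =ᶠ[𝓝 x] (f ∘ (extChartAt 𝓘(ℝ, E) x).symm) ∘ extChartAt 𝓘(ℝ, E) x := by
  filter_upwards [extChartAt_source_mem_nhds (I := 𝓘(ℝ, E)) x] with y hy
  simp only [Function.comp_apply, (extChartAt 𝓘(ℝ, E) x).left_inv hy]

variable [IsManifold 𝓘(ℝ, E) ∞ M] [ContMDiffVectorBundle ∞ F A 𝓘(ℝ, E)]

theorem mvfderiv_comp_proj {f : M → ℝ} (hf : ContMDiff 𝓘(ℝ, E) 𝓘(ℝ, ℝ) ∞ f)
    (p : DualTotal F A) :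
    mvfderiv (dualModel E F) (f ∘ TotalSpace.proj) p =
      baseCovector E p (mvfderiv 𝓘(ℝ, E) f p.proj) := by
  have hf' := (differentiableAt_comp_extChartAt_symm (hf p.proj)).hasFDerivAt
  rw [mvfderiv_eq_of_hasFDerivAt hf' (eventually_comp_extChartAt_symm E f p.proj)]
  refine mvfderiv_eq_of_hasFDerivAt (J := dualModel E F)
    (Ψ := (f ∘ (extChartAt 𝓘(ℝ, E) p.proj).symm) ∘ Prod.fst) ?_ ?_
  · rw [extChartAt_dual_apply]
    exact hf'.comp (extChartAt 𝓘(ℝ, E) p.proj p.proj, _) hasFDerivAt_fst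
  · filter_upwards [eventually_proj (eventually_comp_extChartAt_symm E f p.proj)] with q hq
    simpa only [Function.comp_apply, extChartAt_dual_apply p q] using hq

theorem mvfderiv_sectionFunction_zero (μ : Sections E F A) (x : M) :
    mvfderiv (dualModel E F) (sectionFunction μ) ⟨x, 0⟩ =
      fiberCovector E ⟨x, 0⟩ (fiberCoord F x (μ x)) := by
  set s : M → F := fun y => (trivializationAt F A x ⟨y, μ y⟩).2
  obtain ⟨s', hs⟩ := differentiableAt_comp_extChartAt_symm
    ((contMDiffAt_section x).1 (μ.contMDiff x))
  have s_chart : s ((extChartAt 𝓘(ℝ, E) x).symm (extChartAt 𝓘(ℝ, E) x x)) =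
      fiberCoord F x (μ x) := by
    rw [extChartAt_to_inv]
    rfl
  let z : E × (F →L[ℝ] ℝ) := (extChartAt 𝓘(ℝ, E) x x, 0)
  refine mvfderiv_eq_of_hasFDerivAt (J := dualModel E F)
    (Ψ := fun w : E × (F →L[ℝ] ℝ) => w.2 (s ((extChartAt 𝓘(ℝ, E) x).symm w.1))) ?_ ?_
  · rw [extChartAt_dual_zero]
    refine ((hasFDerivAt_snd (𝕜 := ℝ) (p := z)).clm_apply
      (hs.comp z hasFDerivAt_fst)).congr_fderiv ?_
    refine ContinuousLinearMap.ext fun w : E × (F →L[ℝ] ℝ) => ?_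
    change (0 : F →L[ℝ] ℝ) (s' w.1)
      + w.2 (s ((extChartAt 𝓘(ℝ, E) x).symm (extChartAt 𝓘(ℝ, E) x x))) =
        w.2 (fiberCoord F x (μ x))
    rw [s_chart, zero_apply, zero_add]
  · filter_upwards [eventually_proj (p := ⟨x, 0⟩) (eventually_comp_extChartAt_symm E s x),
      eventually_proj (p := ⟨x, 0⟩) (eventually_mem_baseSet F A x)] with q hq hqx
    rw [Function.comp_apply, Function.comp_apply] at hq
    rw [Function.comp_apply, extChartAt_dual_apply]
    dsimp only
    rw [← hq, trivializationAt_dual_apply hqx, Trivialization.symmL_apply _ hqx]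
    exact congrArg q.snd ((trivializationAt F A x).symm_apply_apply_mk hqx (μ q.proj)).symm

variable [FiniteDimensional ℝ E] [T2Space M] [FiniteDimensional ℝ F]

theorem mvfderiv_sectionFunction_frame (p : DualTotal F A) (i : Fin (Module.finrank ℝ F)) :
    mvfderiv (dualModel E F) (sectionFunction (frame E F A p.proj i)) p =
      fiberCovector E p (Module.finBasis ℝ F i) := by
  refine mvfderiv_eq_of_eventuallyEq (J := dualModel E F)
    (ℓ := fiberCovector E p (Module.finBasis ℝ F i)) ?_
  filter_upwards [eventually_proj (eventually_frame_eq_symmL (E := E) (A := A) p.proj i),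
    eventually_proj (eventually_mem_baseSet F A p.proj)] with q hframe hq
  rw [sectionFunction_apply, hframe, ← trivializationAt_dual_apply hq, Function.comp_apply,
    extChartAt_dual_apply]
  rfl

/-- The differentials of basic functions and of the members of a frame span the cotangent spaces
of `A^*`. -/
theorem covector_linearMap_ext {G : Type*} [AddCommMonoid G] [Module ℝ G] {p : DualTotal F A}
    {Φ Ψ : (TangentSpace (dualModel E F) p →L[ℝ] ℝ) →ₗ[ℝ] G}
    (basic : ∀ f : M → ℝ, ContMDiff 𝓘(ℝ, E) 𝓘(ℝ, ℝ) ∞ f →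
      Φ (mvfderiv (dualModel E F) (f ∘ TotalSpace.proj) p) =
        Ψ (mvfderiv (dualModel E F) (f ∘ TotalSpace.proj) p))
    (linear : ∀ i, Φ (mvfderiv (dualModel E F) (sectionFunction (frame E F A p.proj i)) p) =
      Ψ (mvfderiv (dualModel E F) (sectionFunction (frame E F A p.proj i)) p)) : Φ = Ψ := by
  ext ξ
  obtain ⟨ℓ, a, rfl⟩ := exists_eq_baseCovector_add_fiberCovector p ξ
  obtain ⟨f, hf, rfl⟩ := exists_contMDiff_mvfderiv_eq p.proj ℓ
  have fiber : Φ ∘ₗ fiberCovector E p = Ψ ∘ₗ fiberCovector E p :=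
    (Module.finBasis ℝ F).ext fun i => by
      simpa only [mvfderiv_sectionFunction_frame, LinearMap.comp_apply] using linear i
  rw [map_add, map_add, ← mvfderiv_comp_proj hf, basic f hf]
  exact congrArg _ (LinearMap.congr_fun fiber a)

theorem dualTangentVector_ext {p : DualTotal F A} {v w : TangentSpace (dualModel E F) p}
    (basic : ∀ f : M → ℝ, ContMDiff 𝓘(ℝ, E) 𝓘(ℝ, ℝ) ∞ f →
      mvfderiv (dualModel E F) (f ∘ TotalSpace.proj) p v =
        mvfderiv (dualModel E F) (f ∘ TotalSpace.proj) p w)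
    (linear : ∀ i, mvfderiv (dualModel E F) (sectionFunction (frame E F A p.proj i)) p v =
      mvfderiv (dualModel E F) (sectionFunction (frame E F A p.proj i)) p w) : v = w := by
  let ev (u : TangentSpace (dualModel E F) p) :
      (TangentSpace (dualModel E F) p →L[ℝ] ℝ) →ₗ[ℝ] ℝ :=
    { toFun ξ := ξ u, map_add' _ _ := rfl, map_smul' _ _ := rfl }
  have ev_eq : ev v = ev w := covector_linearMap_ext basic linear
  exact (SeparatingDual.eq_iff_forall_dual_eq (R := ℝ) (V := E × (F →L[ℝ] ℝ))).2
    (LinearMap.congr_fun ev_eq)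

end Charts

/-! ### Linear and basic functions -/

section LinearAndBasicFunctions

variable {E : Type*} [NormedAddCommGroup E] [NormedSpace ℝ E]
  {M : Type*} [TopologicalSpace M] [ChartedSpace E M]
  {F : Type*} [NormedAddCommGroup F] [NormedSpace ℝ F]
  {A : M → Type*} [∀ x, AddCommGroup (A x)] [∀ x, Module ℝ (A x)] [∀ x, TopologicalSpace (A x)]
  {g h : DualTotal F A → ℝ}

theorem isBasicFunction_comp_proj {f : M → ℝ} (hf : ContMDiff 𝓘(ℝ, E) 𝓘(ℝ, ℝ) ∞ f) :
    IsBasicFunction E (f ∘ TotalSpace.proj : DualTotal F A → ℝ) :=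
  ⟨f, hf, fun _ => rfl⟩

theorem IsBasicFunction.neg (hg : IsBasicFunction E g) : IsBasicFunction E (-g) := by
  obtain ⟨a, ha, hga⟩ := hg
  exact ⟨-a, ha.neg, fun p => by simp [hga]⟩

theorem IsBasicFunction.sub (hg : IsBasicFunction E g) (hh : IsBasicFunction E h) :
    IsBasicFunction E (g - h) := by
  obtain ⟨a, ha, hga⟩ := hg
  obtain ⟨b, hb, hhb⟩ := hh
  exact ⟨a - b, ha.sub hb, fun p => by simp [hga, hhb]⟩

theorem IsBasicFunction.mul (hg : IsBasicFunction E g) (hh : IsBasicFunction E h) :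
    IsBasicFunction E (g * h) := by
  obtain ⟨a, ha, hga⟩ := hg
  obtain ⟨b, hb, hhb⟩ := hh
  exact ⟨a * b, ha.mul hb, fun p => by simp [hga, hhb]⟩

theorem IsBasicFunction.eq_comp_proj (hg : IsBasicFunction E g) :
    g = (fun x => g ⟨x, 0⟩) ∘ TotalSpace.proj := by
  obtain ⟨f, -, h⟩ := hg
  ext p
  simp [h]

variable [TopologicalSpace (TotalSpace F A)] [FiberBundle F A] [VectorBundle ℝ F A]

theorem contMDiffAt_covector_of_trivialization (x : M) (ℓ : F →L[ℝ] ℝ) :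
    ContMDiffAt 𝓘(ℝ, E) (dualModel E F) ∞ (fun y =>
      (⟨y, ℓ ∘L (trivializationAt F A x).continuousLinearMapAt ℝ y⟩ : DualTotal F A)) x := by
  refine (contMDiffAt_hom_bundle (E₂ := Bundle.Trivial M ℝ) _).2
    ⟨contMDiffAt_id, (contMDiffAt_const (c := ℓ)).congr_of_eventuallyEq ?_⟩
  filter_upwards [eventually_mem_baseSet F A x] with y hy
  rw [ContinuousLinearMap.inCoordinates_eq hy (by simp)]
  ext a
  simp [hy]

theorem IsLinearFunction.exists_eq_sectionFunction [FiniteDimensional ℝ F]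
    (hh : IsLinearFunction E h) : ∃ μ : Sections E F A, h = sectionFunction μ := by
  let H (x : M) : (F →L[ℝ] ℝ) →ₗ[ℝ] ℝ := (hh.2 x).mk' ∘ₗ
    (ContinuousLinearMap.precomp ℝ (fiberCoord (A := A) F x).toContinuousLinearMap).toLinearMap
  let m (x : M) : A x := (fiberCoord F x).symm ((bidualEquiv F).symm (H x))
  have apply_m (x : M) (α : A x →L[ℝ] ℝ) : α (m x) = h ⟨x, α⟩ := by
    refine (apply_bidualEquiv_symm (H x)
      (α ∘L (fiberCoord F x).symm.toContinuousLinearMap)).trans ?_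
    change h ⟨x, _⟩ = h ⟨x, α⟩
    congr 2
    ext a
    simp
  have contMDiff_m : ContMDiff 𝓘(ℝ, E) (𝓘(ℝ, E).prod 𝓘(ℝ, F)) ∞
      (fun x => TotalSpace.mk' F x (m x)) := fun x => by
    refine (contMDiffAt_section x).2 (contMDiffAt_of_forall_dual fun ℓ => ?_)
    refine ((hh.1 _).comp x (contMDiffAt_covector_of_trivialization x ℓ)).congr_of_eventuallyEq ?_
    filter_upwards [eventually_mem_baseSet F A x] with y hy
    rw [Function.comp_apply, ← apply_m]
    simp [hy]
  exact ⟨⟨m, contMDiff_m⟩, funext fun p => (apply_m p.proj p.snd).symm⟩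

theorem IsLinearFunction.sub (hg : IsLinearFunction E g) (hh : IsLinearFunction E h) :
    IsLinearFunction E (g - h) :=
  ⟨hg.1.sub hh.1, fun x => ((hg.2 x).mk' - (hh.2 x).mk').isLinear⟩

theorem IsBasicFunction.contMDiff (hg : IsBasicFunction E g) :
    ContMDiff (dualModel E F) 𝓘(ℝ, ℝ) ∞ g := by
  obtain ⟨f, hf, h⟩ := hg
  exact (funext h : g = f ∘ TotalSpace.proj) ▸ contMDiff_comp_proj hf

theorem IsBasicFunction.mul_isLinearFunction (hg : IsBasicFunction E g)
    (hh : IsLinearFunction E h) : IsLinearFunction E (g * h) := by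
  refine ⟨hg.contMDiff.mul hh.1, fun x => ?_⟩
  obtain ⟨f, -, hf⟩ := hg
  have mul_eq : (fun α : A x →L[ℝ] ℝ => (g * h) ⟨x, α⟩) = f x • (hh.2 x).mk' :=
    funext fun α => congrArg (· * h ⟨x, α⟩) (hf ⟨x, α⟩)
  exact mul_eq ▸ (f x • (hh.2 x).mk').isLinear

theorem contMDiff_apply_zero (hg : ContMDiff (dualModel E F) 𝓘(ℝ, ℝ) ∞ g) :
    ContMDiff 𝓘(ℝ, E) 𝓘(ℝ, ℝ) ∞ (fun x => g ⟨x, 0⟩) :=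
  hg.comp (contMDiff_zeroSection ℝ (fun x : M => A x →L[ℝ] ℝ))

theorem apply_zero_eq_of_forall_ne_zero (hg : ContMDiff (dualModel E F) 𝓘(ℝ, ℝ) ∞ g) {x : M}
    {β : A x →L[ℝ] ℝ} {c : ℝ} (h : ∀ t : ℝ, t ≠ 0 → g ⟨x, t • β⟩ = c) : g ⟨x, 0⟩ = c := by
  have line_continuous : Continuous (fun t : ℝ => g ⟨x, 0 + t • β⟩) :=
    hg.continuous.comp (contMDiff_fiber_line (E := E) x 0 β).continuous
  have line_eq := line_continuous.ext_on (dense_compl_singleton 0) continuous_const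
    (fun t ht => (by simpa only [zero_add] using h t ht : g ⟨x, 0 + t • β⟩ = c))
  simpa using congrFun line_eq 0

variable [IsManifold 𝓘(ℝ, E) ∞ M] [FiniteDimensional ℝ E] [FiniteDimensional ℝ F] [T2Space M]
  [ContMDiffVectorBundle ∞ F A 𝓘(ℝ, E)]

variable (E F) in
theorem exists_section_apply_ne_zero {x : M} {α : A x →L[ℝ] ℝ} (hα : α ≠ 0) :
    ∃ μ : Sections E F A, α (μ x) ≠ 0 := by
  obtain ⟨a, ha⟩ := DFunLike.ne_iff.1 hα
  obtain ⟨μ, rfl⟩ := exists_section_apply_eq E F a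
  exact ⟨μ, ha⟩

theorem eq_zero_of_mul_isBasicFunction [Nontrivial F]
    (hg : ContMDiff (dualModel E F) 𝓘(ℝ, ℝ) ∞ g)
    (h : ∀ μ : Sections E F A, IsBasicFunction E (g * sectionFunction μ)) : g = 0 := by
  have off_zero {x : M} {α : A x →L[ℝ] ℝ} (hα : α ≠ 0) : g ⟨x, α⟩ = 0 := by
    obtain ⟨μ, hμ⟩ := exists_section_apply_ne_zero E F hα
    have mul_eq := congrFun (h μ).eq_comp_proj ⟨x, α⟩
    simp only [Pi.mul_apply, sectionFunction_apply, Function.comp_apply, zero_apply, mul_zero]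
      at mul_eq
    exact (mul_eq_zero.1 mul_eq).resolve_right hμ
  ext ⟨x, α⟩
  rcases eq_or_ne α 0 with rfl | hα
  · obtain ⟨ℓ, hℓ⟩ := exists_ne (0 : F →L[ℝ] ℝ)
    obtain ⟨a, ha⟩ := DFunLike.ne_iff.1 hℓ
    have hβ : ℓ ∘L (fiberCoord (A := A) F x).toContinuousLinearMap ≠ 0 :=
      DFunLike.ne_iff.2 ⟨(fiberCoord F x).symm a, by simpa using ha⟩
    exact apply_zero_eq_of_forall_ne_zero hg fun t ht => off_zero (smul_ne_zero ht hβ)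
  · exact off_zero hα

theorem isBasicFunction_of_mul_isLinearFunction (hg : ContMDiff (dualModel E F) 𝓘(ℝ, ℝ) ∞ g)
    (h : ∀ μ : Sections E F A, IsLinearFunction E (g * sectionFunction μ)) :
    IsBasicFunction E g := by
  refine ⟨_, contMDiff_apply_zero hg, fun ⟨x, α⟩ => ?_⟩
  rcases eq_or_ne α 0 with rfl | hα
  · rfl
  obtain ⟨μ, hμ⟩ := exists_section_apply_ne_zero E F hα
  refine (apply_zero_eq_of_forall_ne_zero (β := α) hg fun t ht => ?_).symm
  have homogeneous := ((h μ).2 x).map_smul t α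
  simp only [Pi.mul_apply, sectionFunction_apply, smul_apply, smul_eq_mul] at homogeneous
  apply mul_right_cancel₀ (mul_ne_zero ht hμ)
  linear_combination homogeneous

end LinearAndBasicFunctions

/-! ### Linear Jacobi structures -/

section LinearJacobiStructures

variable {E : Type*} [NormedAddCommGroup E] [NormedSpace ℝ E]
  {M : Type*} [TopologicalSpace M] [ChartedSpace E M]
  {F : Type*} [NormedAddCommGroup F] [NormedSpace ℝ F]
  {A : M → Type*} [TopologicalSpace (TotalSpace F A)] [∀ x, AddCommGroup (A x)]
  [∀ x, Module ℝ (A x)] [∀ x, TopologicalSpace (A x)] [FiberBundle F A] [VectorBundle ℝ F A]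
  [IsManifold 𝓘(ℝ, E) ∞ M] [ContMDiffVectorBundle ∞ F A 𝓘(ℝ, E)]

namespace JacobiStructure

/-- Condition (C1): the Jacobi bracket of two linear functions is linear. -/
def BracketIsLinear (S : JacobiStructure (dualModel E F) (DualTotal F A)) : Prop :=
  ∀ f g : DualTotal F A → ℝ, IsLinearFunction E f → IsLinearFunction E g →
    IsLinearFunction E (S.bracket f g)

/-- Condition (C2): the Jacobi bracket of a linear function and the constant `1` is basic. -/
def BracketOneIsBasic (S : JacobiStructure (dualModel E F) (DualTotal F A)) : Prop :=
  ∀ f : DualTotal F A → ℝ, IsLinearFunction E f → IsBasicFunction E (S.bracket f 1)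

variable {S : JacobiStructure (dualModel E F) (DualTotal F A)} {f g : M → ℝ}

theorem isBasicFunction_applyField_sectionFunction (C2 : S.BracketOneIsBasic)
    (μ : Sections E F A) : IsBasicFunction E (applyField S.field (sectionFunction μ)) := by
  simpa only [S.bracket_one_right, neg_neg] using
    (C2 _ (isLinearFunction_sectionFunction μ)).neg

variable [FiniteDimensional ℝ E] [FiniteDimensional ℝ F] [T2Space M] [Nontrivial F]

theorem applyField_comp_proj (C2 : S.BracketOneIsBasic) (hf : ContMDiff 𝓘(ℝ, E) 𝓘(ℝ, ℝ) ∞ f) :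
    applyField S.field (f ∘ TotalSpace.proj) = 0 := by
  refine eq_zero_of_mul_isBasicFunction
    (contMDiff_applyField S.field (contMDiff_comp_proj hf)) fun μ => ?_
  have leibniz := applyField_mul S.field
    ((contMDiff_comp_proj (F := F) (A := A) hf).mdifferentiable (by simp))
    ((contMDiff_sectionFunction μ).mdifferentiable (by simp))
  rw [← sectionFunction_smulSection hf] at leibniz
  rw [mul_comm, ← sub_eq_of_eq_add' leibniz]
  exact (isBasicFunction_applyField_sectionFunction C2 _).sub
    ((isBasicFunction_comp_proj hf).mul (isBasicFunction_applyField_sectionFunction C2 μ))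

theorem bracket_sectionFunction_smulSection (C2 : S.BracketOneIsBasic) (μ η : Sections E F A)
    (hf : ContMDiff 𝓘(ℝ, E) 𝓘(ℝ, ℝ) ∞ f) :
    S.bracket (sectionFunction μ) (sectionFunction (smulSection f hf η)) =
      (f ∘ TotalSpace.proj) * S.bracket (sectionFunction μ) (sectionFunction η)
        + sectionFunction η * S.bivector.onFun (sectionFunction μ) (f ∘ TotalSpace.proj) := by
  rw [sectionFunction_smulSection,
    S.bracket_mul_right ((contMDiff_comp_proj hf).mdifferentiable (by simp))
      ((contMDiff_sectionFunction η).mdifferentiable (by simp)), applyField_comp_proj C2 hf]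
  ring

theorem isBasicFunction_onFun_sectionFunction_comp_proj (C1 : S.BracketIsLinear)
    (C2 : S.BracketOneIsBasic) (μ : Sections E F A) (hf : ContMDiff 𝓘(ℝ, E) 𝓘(ℝ, ℝ) ∞ f) :
    IsBasicFunction E (S.bivector.onFun (sectionFunction μ) (f ∘ TotalSpace.proj)) := by
  refine isBasicFunction_of_mul_isLinearFunction
    (S.bivector.smooth _ _ (contMDiff_sectionFunction μ) (contMDiff_comp_proj hf)) fun η => ?_
  rw [mul_comm, ← sub_eq_of_eq_add' (bracket_sectionFunction_smulSection C2 μ η hf)]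
  exact (C1 _ _ (isLinearFunction_sectionFunction μ) (isLinearFunction_sectionFunction _)).sub
    ((isBasicFunction_comp_proj hf).mul_isLinearFunction
      (C1 _ _ (isLinearFunction_sectionFunction μ) (isLinearFunction_sectionFunction η)))

theorem onFun_comp_proj_comp_proj (C1 : S.BracketIsLinear) (C2 : S.BracketOneIsBasic)
    (hf : ContMDiff 𝓘(ℝ, E) 𝓘(ℝ, ℝ) ∞ f) (hg : ContMDiff 𝓘(ℝ, E) 𝓘(ℝ, ℝ) ∞ g) :
    S.bivector.onFun (f ∘ TotalSpace.proj) (g ∘ TotalSpace.proj) = 0 := by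
  refine eq_zero_of_mul_isBasicFunction
    (S.bivector.smooth _ _ (contMDiff_comp_proj hf) (contMDiff_comp_proj hg)) fun μ => ?_
  have leibniz := S.bivector.onFun_mul_left (f := g ∘ TotalSpace.proj)
    ((contMDiff_comp_proj (F := F) (A := A) hf).mdifferentiable (by simp))
    ((contMDiff_sectionFunction μ).mdifferentiable (by simp))
  rw [← sectionFunction_smulSection hf] at leibniz
  rw [mul_comm, ← sub_eq_of_eq_add' leibniz]
  exact (isBasicFunction_onFun_sectionFunction_comp_proj C1 C2 _ hg).sub
    ((isBasicFunction_comp_proj hf).mul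
      (isBasicFunction_onFun_sectionFunction_comp_proj C1 C2 μ hg))

end JacobiStructure

end LinearJacobiStructures

/-! ### The Lie algebroid and the 1-cocycle of a linear Jacobi structure -/

section AlgebroidOfJacobi

variable {E : Type*} [NormedAddCommGroup E] [NormedSpace ℝ E]
  {M : Type*} [TopologicalSpace M] [ChartedSpace E M]
  {F : Type*} [NormedAddCommGroup F] [NormedSpace ℝ F]
  {A : M → Type*} [TopologicalSpace (TotalSpace F A)] [∀ x, AddCommGroup (A x)]
  [∀ x, Module ℝ (A x)] [∀ x, TopologicalSpace (A x)] [FiberBundle F A] [VectorBundle ℝ F A]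

/-- The function `φ(μ)` on `M`, for `φ ∈ Γ(A^*)` and `μ ∈ Γ(A)`. -/
def pairing (φ : DualSections E F A) (μ : Sections E F A) : M → ℝ := fun x => φ x (μ x)

theorem contMDiff_pairing (φ : DualSections E F A) (μ : Sections E F A) :
    ContMDiff 𝓘(ℝ, E) 𝓘(ℝ, ℝ) ∞ (pairing φ μ) :=
  (contMDiff_sectionFunction μ).comp φ.contMDiff

variable [IsManifold 𝓘(ℝ, E) ∞ M] [ContMDiffVectorBundle ∞ F A 𝓘(ℝ, E)]

namespace JacobiStructure

section SectionBracket

variable [FiniteDimensional ℝ F] {S : JacobiStructure (dualModel E F) (DualTotal F A)}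

/-- The section `[μ, η]` whose linear function is the Jacobi bracket of `μ̃` and `η̃`. -/
def sectionBracket (C1 : S.BracketIsLinear) (μ η : Sections E F A) : Sections E F A :=
  (C1 _ _ (isLinearFunction_sectionFunction μ)
    (isLinearFunction_sectionFunction η)).exists_eq_sectionFunction.choose

theorem sectionFunction_sectionBracket (C1 : S.BracketIsLinear) (μ η : Sections E F A) :
    sectionFunction (sectionBracket C1 μ η) =
      S.bracket (sectionFunction μ) (sectionFunction η) :=
  (C1 _ _ (isLinearFunction_sectionFunction μ)
    (isLinearFunction_sectionFunction η)).exists_eq_sectionFunction.choose_spec.symm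

theorem sectionBracket_swap (C1 : S.BracketIsLinear) (μ η : Sections E F A) :
    sectionBracket C1 μ η = -sectionBracket C1 η μ := by
  apply sectionFunction_injective
  rw [map_neg, sectionFunction_sectionBracket, sectionFunction_sectionBracket, S.bracket_swap]

theorem sectionBracket_add_right (C1 : S.BracketIsLinear) (μ η ζ : Sections E F A) :
    sectionBracket C1 μ (η + ζ) = sectionBracket C1 μ η + sectionBracket C1 μ ζ := by
  apply sectionFunction_injective
  simp only [map_add, sectionFunction_sectionBracket]
  exact S.bracket_add_right ((contMDiff_sectionFunction η).mdifferentiable (by simp))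
    ((contMDiff_sectionFunction ζ).mdifferentiable (by simp))

theorem sectionBracket_smul_right (C1 : S.BracketIsLinear) (c : ℝ) (μ η : Sections E F A) :
    sectionBracket C1 μ (c • η) = c • sectionBracket C1 μ η := by
  apply sectionFunction_injective
  simp only [map_smul, sectionFunction_sectionBracket]
  exact S.bracket_smul_right c ((contMDiff_sectionFunction η).mdifferentiable (by simp))

/-- The bracket of sections as a bilinear map. -/
def sectionBracketBilin (C1 : S.BracketIsLinear) :
    Sections E F A →ₗ[ℝ] Sections E F A →ₗ[ℝ] Sections E F A :=
  LinearMap.mk₂ ℝ (sectionBracket C1)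
    (fun μ η ζ => by
      rw [sectionBracket_swap, sectionBracket_add_right, sectionBracket_swap C1 μ,
        sectionBracket_swap C1 η, neg_add])
    (fun c μ η => by
      rw [sectionBracket_swap, sectionBracket_smul_right, sectionBracket_swap C1 μ, smul_neg])
    (sectionBracket_add_right C1)
    (sectionBracket_smul_right C1)

theorem sectionBracket_self (C1 : S.BracketIsLinear) (μ : Sections E F A) :
    sectionBracket C1 μ μ = 0 := by
  apply sectionFunction_injective
  rw [map_zero, sectionFunction_sectionBracket, S.bracket_self]

theorem sectionBracket_jacobi (C1 : S.BracketIsLinear) (μ η ζ : Sections E F A) :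
    sectionBracket C1 μ (sectionBracket C1 η ζ) + sectionBracket C1 η (sectionBracket C1 ζ μ)
      + sectionBracket C1 ζ (sectionBracket C1 μ η) = 0 := by
  apply sectionFunction_injective
  simp only [map_add, map_zero, sectionFunction_sectionBracket]
  exact S.jacobi_identity (contMDiff_sectionFunction μ) (contMDiff_sectionFunction η)
    (contMDiff_sectionFunction ζ)

end SectionBracket

variable (S : JacobiStructure (dualModel E F) (DualTotal F A))

/-- The value at `x` of the 1-cocycle `φ` of a linear Jacobi structure on `A^*`. It is read off
from `E = -φ^v` at the zero of `A_x^*`, where `dμ̃` depends only on `μ(x)`. -/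
def cocycleAt (x : M) : A x →L[ℝ] ℝ :=
  -(show E × (F →L[ℝ] ℝ) from S.field ⟨x, 0⟩).2 ∘L (fiberCoord F x).toContinuousLinearMap

theorem cocycleAt_apply (μ : Sections E F A) (x : M) :
    S.cocycleAt x (μ x) = -applyField S.field (sectionFunction μ) ⟨x, 0⟩ := by
  rw [applyField, mvfderiv_sectionFunction_zero]
  rfl

variable [FiniteDimensional ℝ E] [FiniteDimensional ℝ F]

/-- The value at `x` of the anchor `ρ` of a linear Jacobi structure on `A^*`: in the bidual,
`ρ(μ)(x)` is the form `ℓ ↦ Λ(dμ̃, ℓ ∘ dπ^*)` at the zero of `A_x^*`. -/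
def anchorAt (x : M) : A x →L[ℝ] TangentSpace 𝓘(ℝ, E) x :=
  LinearMap.toContinuousLinearMap ((bidualEquiv E).symm.toLinearMap ∘ₗ
    (S.bivector.toFun ⟨x, 0⟩).compl₁₂ (fiberCovector E ⟨x, 0⟩) (baseCovector E ⟨x, 0⟩))
      ∘L (fiberCoord F x).toContinuousLinearMap

theorem mvfderiv_anchorAt (μ : Sections E F A) {f : M → ℝ}
    (hf : ContMDiff 𝓘(ℝ, E) 𝓘(ℝ, ℝ) ∞ f) (x : M) :
    mvfderiv 𝓘(ℝ, E) f x (S.anchorAt x (μ x)) =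
      S.bivector.onFun (sectionFunction μ) (f ∘ TotalSpace.proj) ⟨x, 0⟩ := by
  rw [BivectorField.onFun, mvfderiv_sectionFunction_zero, mvfderiv_comp_proj hf]
  exact apply_bidualEquiv_symm (V := E) _ (mvfderiv 𝓘(ℝ, E) f x)

variable [T2Space M]

/-- The 1-cocycle `φ` of a linear Jacobi structure on `A^*`. -/
def cocycle : DualSections E F A :=
  ⟨S.cocycleAt, contMDiff_hom_of_forall (B := Bundle.Trivial M ℝ) S.cocycleAt fun μ x => by
    refine (contMDiffAt_section (E := Bundle.Trivial M ℝ) x).2 ?_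
    refine (contMDiff_apply_zero (contMDiff_applyField S.field
      (contMDiff_sectionFunction μ))).neg x |>.congr_of_eventuallyEq (.of_forall fun y => ?_)
    exact S.cocycleAt_apply μ y⟩

/-- The anchor `ρ` of a linear Jacobi structure on `A^*`. -/
def anchor : Cₛ^∞⟮𝓘(ℝ, E); F →L[ℝ] E, fun x : M => A x →L[ℝ] TangentSpace 𝓘(ℝ, E) x⟯ :=
  ⟨S.anchorAt, contMDiff_hom_of_forall S.anchorAt fun μ =>
    contMDiff_vectorField_of_forall fun f hf => by
      simp only [S.mvfderiv_anchorAt μ hf]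
      exact contMDiff_apply_zero
        (S.bivector.smooth _ _ (contMDiff_sectionFunction μ) (contMDiff_comp_proj hf))⟩

/-- The vector field `ρ(μ)`. -/
def anchorField (μ : Sections E F A) : SmoothVectorField E M :=
  ⟨fun x => S.anchor x (μ x), ContMDiff.clm_bundle_apply S.anchor.contMDiff μ.contMDiff⟩

variable {S} {f : M → ℝ}

theorem applyField_sectionFunction (C2 : S.BracketOneIsBasic) (μ : Sections E F A) :
    applyField S.field (sectionFunction μ) = -pairing S.cocycle μ ∘ TotalSpace.proj := by
  rw [(isBasicFunction_applyField_sectionFunction C2 μ).eq_comp_proj]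
  ext p
  exact neg_eq_iff_eq_neg.1 (S.cocycleAt_apply μ p.proj).symm

/-! ### The operators `ρ(μ) + φ(μ)` -/

variable (S) in
/-- The first-order operator `D_μ = ρ(μ) + φ(μ)` on functions on `M`. It represents the Jacobi
bracket with `μ̃` on basic functions. -/
def twistedDeriv (μ : Sections E F A) (f : M → ℝ) : M → ℝ :=
  applyField (S.anchorField μ) f + f * pairing S.cocycle μ

theorem contMDiff_twistedDeriv (μ : Sections E F A) (hf : ContMDiff 𝓘(ℝ, E) 𝓘(ℝ, ℝ) ∞ f) :
    ContMDiff 𝓘(ℝ, E) 𝓘(ℝ, ℝ) ∞ (S.twistedDeriv μ f) :=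
  (contMDiff_applyField _ hf).add (hf.mul (contMDiff_pairing _ μ))

theorem twistedDeriv_one (μ : Sections E F A) : S.twistedDeriv μ 1 = pairing S.cocycle μ := by
  rw [twistedDeriv, Pi.one_def, applyField_const, ← Pi.one_def, zero_add, one_mul]

theorem twistedDeriv_twistedDeriv (μ η : Sections E F A) (hf : ContMDiff 𝓘(ℝ, E) 𝓘(ℝ, ℝ) ∞ f) :
    S.twistedDeriv μ (S.twistedDeriv η f) =
      applyField (S.anchorField μ) (applyField (S.anchorField η) f)
        + f * applyField (S.anchorField μ) (pairing S.cocycle η)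
        + pairing S.cocycle η * applyField (S.anchorField μ) f
        + pairing S.cocycle μ * applyField (S.anchorField η) f
        + f * pairing S.cocycle η * pairing S.cocycle μ := by
  have hη := contMDiff_pairing S.cocycle η
  rw [twistedDeriv, twistedDeriv,
    applyField_add _ ((contMDiff_applyField _ hf).mdifferentiable (by simp))
      ((hf.mul hη).mdifferentiable (by simp)),
    applyField_mul _ (hf.mdifferentiable (by simp)) (hη.mdifferentiable (by simp))]
  ring

variable [Nontrivial F]

theorem onFun_sectionFunction_comp_proj (C1 : S.BracketIsLinear)
    (C2 : S.BracketOneIsBasic) (μ : Sections E F A) (hf : ContMDiff 𝓘(ℝ, E) 𝓘(ℝ, ℝ) ∞ f) :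
    S.bivector.onFun (sectionFunction μ) (f ∘ TotalSpace.proj) =
      applyField (S.anchorField μ) f ∘ TotalSpace.proj := by
  rw [(isBasicFunction_onFun_sectionFunction_comp_proj C1 C2 μ hf).eq_comp_proj]
  ext p
  exact (S.mvfderiv_anchorAt μ hf p.proj).symm

theorem sectionBracket_smulSection (C1 : S.BracketIsLinear) (C2 : S.BracketOneIsBasic)
    (hf : ContMDiff 𝓘(ℝ, E) 𝓘(ℝ, ℝ) ∞ f) (μ η : Sections E F A) :
    sectionBracket C1 μ (smulSection f hf η) = smulSection f hf (sectionBracket C1 μ η)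
      + smulSection (applyField (S.anchorField μ) f) (contMDiff_applyField _ hf) η := by
  apply sectionFunction_injective
  rw [map_add, sectionFunction_sectionBracket, bracket_sectionFunction_smulSection C2,
    onFun_sectionFunction_comp_proj C1 C2 μ hf, sectionFunction_smulSection,
    sectionFunction_smulSection, sectionFunction_sectionBracket, mul_comm (sectionFunction η)]

theorem bracket_sectionFunction_comp_proj (C1 : S.BracketIsLinear) (C2 : S.BracketOneIsBasic)
    (μ : Sections E F A) (hf : ContMDiff 𝓘(ℝ, E) 𝓘(ℝ, ℝ) ∞ f) :
    S.bracket (sectionFunction μ) (f ∘ TotalSpace.proj) =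
      S.twistedDeriv μ f ∘ TotalSpace.proj := by
  rw [bracket, onFun_sectionFunction_comp_proj C1 C2 μ hf, applyField_comp_proj C2 hf,
    applyField_sectionFunction C2, twistedDeriv]
  ext p
  simp

theorem twistedDeriv_sectionBracket (C1 : S.BracketIsLinear) (C2 : S.BracketOneIsBasic)
    (μ η : Sections E F A) (hf : ContMDiff 𝓘(ℝ, E) 𝓘(ℝ, ℝ) ∞ f) :
    S.twistedDeriv (sectionBracket C1 μ η) f =
      S.twistedDeriv μ (S.twistedDeriv η f) - S.twistedDeriv η (S.twistedDeriv μ f) := by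
  have jacobi := S.jacobi_identity (contMDiff_sectionFunction μ) (contMDiff_sectionFunction η)
    (contMDiff_comp_proj hf)
  have represent (μ : Sections E F A) {f : M → ℝ} (hf : ContMDiff 𝓘(ℝ, E) 𝓘(ℝ, ℝ) ∞ f) :=
    bracket_sectionFunction_comp_proj C1 C2 μ hf
  rw [S.bracket_swap (f ∘ _), S.bracket_swap (f ∘ _), represent η hf, represent μ hf,
    S.bracket_neg_right
      ((contMDiff_comp_proj (contMDiff_twistedDeriv μ hf)).mdifferentiable (by simp)),
    represent μ (contMDiff_twistedDeriv η hf), represent η (contMDiff_twistedDeriv μ hf),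
    ← sectionFunction_sectionBracket C1, represent _ hf] at jacobi
  ext x
  have jacobi_at_x := congrFun jacobi ⟨x, 0⟩
  simp only [Pi.add_apply, Pi.neg_apply, Function.comp_apply, Pi.zero_apply] at jacobi_at_x
  simp only [Pi.sub_apply]
  linarith

theorem pairing_cocycle_sectionBracket (C1 : S.BracketIsLinear) (C2 : S.BracketOneIsBasic)
    (μ η : Sections E F A) :
    pairing S.cocycle (sectionBracket C1 μ η) =
      applyField (S.anchorField μ) (pairing S.cocycle η)
        - applyField (S.anchorField η) (pairing S.cocycle μ) := by
  have commutator_one := twistedDeriv_sectionBracket C1 C2 μ η contMDiff_one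
  rw [twistedDeriv_one, twistedDeriv_one, twistedDeriv_one] at commutator_one
  rw [commutator_one, twistedDeriv, twistedDeriv]
  ring

theorem anchorField_sectionBracket (C1 : S.BracketIsLinear) (C2 : S.BracketOneIsBasic)
    (μ η : Sections E F A) :
    S.anchorField (sectionBracket C1 μ η) =
      SmoothVectorField.lieBracket (S.anchorField μ) (S.anchorField η) := by
  refine ContMDiffSection.ext fun x => tangentVector_ext fun f hf => ?_
  refine congrFun (f := applyField _ f) (g := applyField _ f) ?_ x
  have commutator := twistedDeriv_sectionBracket C1 C2 μ η hf
  rw [twistedDeriv_twistedDeriv μ η hf, twistedDeriv_twistedDeriv η μ hf, twistedDeriv,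
    pairing_cocycle_sectionBracket C1 C2] at commutator
  rw [SmoothVectorField.applyField_lieBracket _ _ hf]
  linear_combination commutator

/-- The Lie algebroid structure on `A` of a linear Jacobi structure on `A^*`. -/
def lieAlgebroid (C1 : S.BracketIsLinear) (C2 : S.BracketOneIsBasic) : LieAlgebroid E F A where
  bracket := sectionBracketBilin C1
  bracket_self := sectionBracket_self C1
  jacobi := sectionBracket_jacobi C1
  anchor := S.anchor
  anchor_bracket μ η := DFunLike.congr_fun (anchorField_sectionBracket C1 C2 μ η)
  leibniz _ hf μ η := DFunLike.congr_fun (sectionBracket_smulSection C1 C2 hf μ η)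

theorem isCocycle_cocycle (C1 : S.BracketIsLinear) (C2 : S.BracketOneIsBasic) :
    (lieAlgebroid C1 C2).IsCocycle S.cocycle :=
  fun μ η => congrFun (pairing_cocycle_sectionBracket C1 C2 μ η)

end JacobiStructure

end AlgebroidOfJacobi

/-! ### The dual bivector in coordinates -/

section Wedge

variable {E : Type*} [NormedAddCommGroup E] [NormedSpace ℝ E] {H : Type*} [TopologicalSpace H]
  (J : ModelWithCorners ℝ E H) {N : Type*} [TopologicalSpace N] [ChartedSpace H N]

theorem wedge_apply {p : N} (X Y : TangentSpace J p) (ξ ζ : TangentSpace J p →L[ℝ] ℝ) :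
    wedge J X Y ξ ζ = ξ X * ζ Y - ξ Y * ζ X := rfl

theorem wedge_apply_swap {p : N} (X Y : TangentSpace J p) (ξ ζ : TangentSpace J p →L[ℝ] ℝ) :
    wedge J X Y ξ ζ = -wedge J X Y ζ ξ := by
  rw [wedge_apply, wedge_apply]
  ring

end Wedge

theorem sum_sum_Ioi_mul_sub_of_antisymm {ι R : Type*} [Fintype ι] [LinearOrder ι]
    [LocallyFiniteOrderTop ι] [LocallyFiniteOrderBot ι] [CommRing R] {c : ι → ι → R}
    (c_self : ∀ i, c i i = 0) (c_swap : ∀ i j, c i j = -c j i) (u v : ι → R) :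
    ∑ i, ∑ j ∈ Finset.Ioi i, c i j * (u i * v j - u j * v i) = ∑ i, ∑ j, c i j * (u i * v j) := by
  calc ∑ i, ∑ j ∈ Finset.Ioi i, c i j * (u i * v j - u j * v i)
      = ∑ i, ∑ j ∈ Finset.Ioi i, (c i j * (u i * v j) + c j i * (u j * v i)) := by
        refine Finset.sum_congr rfl fun i _ => Finset.sum_congr rfl fun j _ => ?_
        rw [c_swap j i]
        ring
    _ = ∑ i, ∑ j ∈ {i}ᶜ, c i j * (u i * v j) :=
        Finset.sum_sum_Ioi_add_eq_sum_sum_off_diag fun j i => c i j * (u i * v j)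
    _ = ∑ i, ∑ j, c i j * (u i * v j) := by
        refine Finset.sum_congr rfl fun i _ => ?_
        rw [Fintype.sum_eq_add_sum_compl i, c_self, zero_mul, zero_add]

section DualBivector

variable {E : Type*} [NormedAddCommGroup E] [NormedSpace ℝ E]
  {M : Type*} [TopologicalSpace M] [ChartedSpace E M]
  {F : Type*} [NormedAddCommGroup F] [NormedSpace ℝ F]
  {A : M → Type*} [TopologicalSpace (TotalSpace F A)] [∀ x, AddCommGroup (A x)]
  [∀ x, Module ℝ (A x)] [∀ x, TopologicalSpace (A x)] [FiberBundle F A] [VectorBundle ℝ F A]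

variable [IsManifold 𝓘(ℝ, E) ∞ M]

namespace LieAlgebroid

theorem bracket_swap (L : LieAlgebroid E F A) (μ η : Sections E F A) :
    L.bracket μ η = -L.bracket η μ := by
  have bracket_add_self := L.bracket_self (μ + η)
  simp only [map_add, LinearMap.add_apply, L.bracket_self, zero_add, add_zero]
    at bracket_add_self
  exact eq_neg_of_add_eq_zero_right bracket_add_self

end LieAlgebroid

variable [ContMDiffVectorBundle ∞ F A 𝓘(ℝ, E)]

theorem mvfderiv_comp_proj_partialMu [FiniteDimensional ℝ F] {f : M → ℝ}
    (hf : ContMDiff 𝓘(ℝ, E) 𝓘(ℝ, ℝ) ∞ f) (p : DualTotal F A) (i : Fin (Module.finrank ℝ F)) :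
    mvfderiv (dualModel E F) (f ∘ TotalSpace.proj) p (partialMu E p i) = 0 := by
  rw [mvfderiv_comp_proj hf]
  exact map_zero (mvfderiv 𝓘(ℝ, E) f p.proj)

theorem mvfderiv_comp_proj_partialX [FiniteDimensional ℝ E] {f : M → ℝ}
    (hf : ContMDiff 𝓘(ℝ, E) 𝓘(ℝ, ℝ) ∞ f) (p : DualTotal F A) (l : Fin (Module.finrank ℝ E)) :
    mvfderiv (dualModel E F) (f ∘ TotalSpace.proj) p (partialX E p l) =
      mvfderiv 𝓘(ℝ, E) f p.proj (Module.finBasis ℝ E l) := by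
  rw [mvfderiv_comp_proj hf]
  rfl

variable [FiniteDimensional ℝ E] [T2Space M] [FiniteDimensional ℝ F]

theorem mvfderiv_frame_partialMu (p : DualTotal F A) (a i : Fin (Module.finrank ℝ F)) :
    mvfderiv (dualModel E F) (sectionFunction (frame E F A p.proj a)) p (partialMu E p i) =
      if a = i then 1 else 0 := by
  rw [mvfderiv_sectionFunction_frame]
  exact (Module.finBasis ℝ F).repr_self_apply a i

theorem mvfderiv_frame_partialX (p : DualTotal F A) (a : Fin (Module.finrank ℝ F))
    (l : Fin (Module.finrank ℝ E)) :
    mvfderiv (dualModel E F) (sectionFunction (frame E F A p.proj a)) p (partialX E p l) = 0 := by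
  rw [mvfderiv_sectionFunction_frame]
  rfl

namespace LieAlgebroid

variable (L : LieAlgebroid E F A)

theorem sum_structureFunction (p : DualTotal F A) (i j : Fin (Module.finrank ℝ F)) :
    ∑ k, L.structureFunction p.proj i j k * p.snd (frame E F A p.proj k p.proj) =
      sectionFunction (L.bracket (frame E F A p.proj i) (frame E F A p.proj j)) p := by
  rw [sectionFunction_apply, ← ((trivializationAt F A p.proj).basisAt (Module.finBasis ℝ F)
    (mem_baseSet_trivializationAt F A p.proj)).sum_repr (L.bracket _ _ p.proj), map_sum]
  simp only [map_smul, smul_eq_mul, frame_self, structureFunction]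

theorem sum_anchorComponent (x : M) (i : Fin (Module.finrank ℝ F)) (ℓ : E →L[ℝ] ℝ) :
    ∑ l, L.anchorComponent x i l * ℓ (Module.finBasis ℝ E l) =
      ℓ (L.anchor x (frame E F A x i x)) := by
  conv_rhs => rw [← (Module.finBasis ℝ E).sum_repr (L.anchor x (frame E F A x i x)), map_sum]
  simp only [map_smul, smul_eq_mul, anchorComponent]

theorem linearPoisson_apply (p : DualTotal F A) (ξ ζ : TangentSpace (dualModel E F) p →L[ℝ] ℝ) :
    L.linearPoisson p ξ ζ =
      (∑ i, ∑ j, sectionFunction (L.bracket (frame E F A p.proj i) (frame E F A p.proj j)) p *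
        (ξ (partialMu E p i) * ζ (partialMu E p j)))
      + ∑ i, ∑ l, L.anchorComponent p.proj i l *
        (ξ (partialMu E p i) * ζ (partialX E p l) - ξ (partialX E p l) * ζ (partialMu E p i)) := by
  rw [← sum_sum_Ioi_mul_sub_of_antisymm
    (fun i => by rw [L.bracket_self, map_zero, Pi.zero_apply])
    (fun i j => by rw [L.bracket_swap, map_neg, Pi.neg_apply])]
  simp only [linearPoisson, LinearMap.add_apply, LinearMap.sum_apply, LinearMap.smul_apply,
    wedge_apply, smul_eq_mul, ← sum_structureFunction, Finset.sum_mul]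

theorem linearPoisson_frame_frame (p : DualTotal F A) (a b : Fin (Module.finrank ℝ F)) :
    L.linearPoisson p
      (mvfderiv (dualModel E F) (sectionFunction (frame E F A p.proj a)) p)
      (mvfderiv (dualModel E F) (sectionFunction (frame E F A p.proj b)) p) =
      sectionFunction (L.bracket (frame E F A p.proj a) (frame E F A p.proj b)) p := by
  simp [linearPoisson_apply, mvfderiv_frame_partialMu, mvfderiv_frame_partialX]

theorem linearPoisson_frame_comp_proj (p : DualTotal F A) (a : Fin (Module.finrank ℝ F))
    {f : M → ℝ} (hf : ContMDiff 𝓘(ℝ, E) 𝓘(ℝ, ℝ) ∞ f) :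
    L.linearPoisson p
      (mvfderiv (dualModel E F) (sectionFunction (frame E F A p.proj a)) p)
      (mvfderiv (dualModel E F) (f ∘ TotalSpace.proj) p) =
      mvfderiv 𝓘(ℝ, E) f p.proj (L.anchor p.proj (frame E F A p.proj a p.proj)) := by
  simp only [linearPoisson_apply, mvfderiv_frame_partialMu, mvfderiv_frame_partialX,
    mvfderiv_comp_proj_partialMu hf, mvfderiv_comp_proj_partialX hf, mul_zero, sub_zero, zero_add,
    Finset.sum_const_zero, ite_mul, one_mul, zero_mul, mul_ite, Finset.sum_ite_irrel,
    Finset.sum_ite_eq, Finset.mem_univ, if_true]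
  exact L.sum_anchorComponent p.proj a (mvfderiv 𝓘(ℝ, E) f p.proj)

theorem linearPoisson_comp_proj_comp_proj (p : DualTotal F A) {f g : M → ℝ}
    (hf : ContMDiff 𝓘(ℝ, E) 𝓘(ℝ, ℝ) ∞ f) (hg : ContMDiff 𝓘(ℝ, E) 𝓘(ℝ, ℝ) ∞ g) :
    L.linearPoisson p (mvfderiv (dualModel E F) (f ∘ TotalSpace.proj) p)
      (mvfderiv (dualModel E F) (g ∘ TotalSpace.proj) p) = 0 := by
  simp [linearPoisson_apply, mvfderiv_comp_proj_partialMu hf, mvfderiv_comp_proj_partialMu hg]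

variable (φ : DualSections E F A)

theorem dualBivector_swap (p : DualTotal F A) (ξ ζ : TangentSpace (dualModel E F) p →L[ℝ] ℝ) :
    L.dualBivector φ p ξ ζ = -L.dualBivector φ p ζ ξ := by
  simp only [dualBivector, linearPoisson, LinearMap.add_apply, LinearMap.sum_apply,
    LinearMap.smul_apply, wedge_apply_swap _ _ _ ξ, smul_neg, Finset.sum_neg_distrib, neg_add]

theorem dualBivector_frame_frame (p : DualTotal F A) (a b : Fin (Module.finrank ℝ F)) :
    L.dualBivector φ p
      (mvfderiv (dualModel E F) (sectionFunction (frame E F A p.proj a)) p)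
      (mvfderiv (dualModel E F) (sectionFunction (frame E F A p.proj b)) p) =
      sectionFunction (L.bracket (frame E F A p.proj a) (frame E F A p.proj b)) p
        + (sectionFunction (frame E F A p.proj a) p * pairing φ (frame E F A p.proj b) p.proj
        - pairing φ (frame E F A p.proj a) p.proj * sectionFunction (frame E F A p.proj b) p) := by
  rw [dualBivector, LinearMap.add_apply, LinearMap.add_apply, linearPoisson_frame_frame,
    wedge_apply, liouville, verticalLift]
  simp only [mvfderiv_sectionFunction_verticalVector]
  rfl

theorem dualBivector_apply_comp_proj (p : DualTotal F A)
    (ξ : TangentSpace (dualModel E F) p →L[ℝ] ℝ) {f : M → ℝ}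
    (hf : ContMDiff 𝓘(ℝ, E) 𝓘(ℝ, ℝ) ∞ f) :
    L.dualBivector φ p ξ (mvfderiv (dualModel E F) (f ∘ TotalSpace.proj) p) =
      L.linearPoisson p ξ (mvfderiv (dualModel E F) (f ∘ TotalSpace.proj) p) := by
  rw [dualBivector, LinearMap.add_apply, LinearMap.add_apply, wedge_apply, liouville,
    verticalLift, mvfderiv_comp_proj_verticalVector hf, mvfderiv_comp_proj_verticalVector hf,
    mul_zero, mul_zero, sub_zero, add_zero]

end LieAlgebroid

namespace JacobiStructure

variable {S : JacobiStructure (dualModel E F) (DualTotal F A)}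

theorem onFun_sectionFunction_sectionFunction (C1 : S.BracketIsLinear)
    (C2 : S.BracketOneIsBasic) (μ η : Sections E F A) :
    S.bivector.onFun (sectionFunction μ) (sectionFunction η) =
      sectionFunction (sectionBracket C1 μ η)
        + (sectionFunction μ * (pairing S.cocycle η ∘ TotalSpace.proj)
          - (pairing S.cocycle μ ∘ TotalSpace.proj) * sectionFunction η) := by
  rw [sectionFunction_sectionBracket, bracket, applyField_sectionFunction C2,
    applyField_sectionFunction C2]
  ext p
  simp only [Pi.add_apply, Pi.sub_apply, Pi.mul_apply, Pi.neg_apply, Function.comp_apply]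
  ring

variable [Nontrivial F]

theorem field_eq_dualField (C2 : S.BracketOneIsBasic) (p : DualTotal F A) :
    S.field p = dualField S.cocycle p := by
  refine dualTangentVector_ext (fun f hf => ?_) fun i => ?_
  · rw [dualField, verticalLift, ContinuousLinearMap.map_neg,
      mvfderiv_comp_proj_verticalVector hf, neg_zero]
    exact congrFun (applyField_comp_proj C2 hf) p
  · rw [dualField, verticalLift, ContinuousLinearMap.map_neg,
      mvfderiv_sectionFunction_verticalVector]
    exact congrFun (applyField_sectionFunction C2 _) p

theorem bivector_eq_dualBivector (C1 : S.BracketIsLinear) (C2 : S.BracketOneIsBasic)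
    (p : DualTotal F A) :
    S.bivector.toFun p = (lieAlgebroid C1 C2).dualBivector S.cocycle p := by
  have linear_basic (i) {f : M → ℝ} (hf : ContMDiff 𝓘(ℝ, E) 𝓘(ℝ, ℝ) ∞ f) :
      S.bivector.toFun p (mvfderiv (dualModel E F) (sectionFunction (frame E F A p.proj i)) p)
        (mvfderiv (dualModel E F) (f ∘ TotalSpace.proj) p) =
      (lieAlgebroid C1 C2).dualBivector S.cocycle p
        (mvfderiv (dualModel E F) (sectionFunction (frame E F A p.proj i)) p)
        (mvfderiv (dualModel E F) (f ∘ TotalSpace.proj) p) := by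
    rw [LieAlgebroid.dualBivector_apply_comp_proj _ _ _ _ hf,
      LieAlgebroid.linearPoisson_frame_comp_proj _ p i hf]
    exact congrFun (onFun_sectionFunction_comp_proj C1 C2 _ hf) p
  refine covector_linearMap_ext (fun f hf => ?_) fun i => ?_
  · refine covector_linearMap_ext (fun g hg => ?_) fun j => ?_
    · rw [LieAlgebroid.dualBivector_apply_comp_proj _ _ _ _ hg,
        LieAlgebroid.linearPoisson_comp_proj_comp_proj _ p hf hg]
      exact congrFun (onFun_comp_proj_comp_proj C1 C2 hf hg) p
    · rw [S.bivector.toFun_swap, LieAlgebroid.dualBivector_swap, linear_basic j hf]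
  · refine covector_linearMap_ext (fun g hg => linear_basic i hg) fun j => ?_
    rw [LieAlgebroid.dualBivector_frame_frame]
    exact congrFun (onFun_sectionFunction_sectionFunction C1 C2 _ _) p

end JacobiStructure

end DualBivector

end

theorem theorem2
    {E : Type*} [NormedAddCommGroup E] [NormedSpace ℝ E] [FiniteDimensional ℝ E]
    {M : Type*} [TopologicalSpace M] [T2Space M] [ChartedSpace E M] [IsManifold 𝓘(ℝ, E) ∞ M]
    {F : Type*} [NormedAddCommGroup F] [NormedSpace ℝ F] [FiniteDimensional ℝ F]
    (hrank : 0 < Module.finrank ℝ F)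
    {A : M → Type*} [TopologicalSpace (TotalSpace F A)] [∀ x, AddCommGroup (A x)]
    [∀ x, Module ℝ (A x)] [∀ x, TopologicalSpace (A x)] [FiberBundle F A] [VectorBundle ℝ F A]
    [ContMDiffVectorBundle ∞ F A 𝓘(ℝ, E)]
    (S : JacobiStructure (dualModel E F) (DualTotal F A))
    (C1 : ∀ f g : DualTotal F A → ℝ, IsLinearFunction E f → IsLinearFunction E g →
      IsLinearFunction E (S.bracket f g))
    (C2 : ∀ f : DualTotal F A → ℝ, IsLinearFunction E f →
      IsBasicFunction E (S.bracket f 1)) :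
    ∃ (L : LieAlgebroid E F A) (φ : DualSections E F A), L.IsCocycle φ ∧
      (∀ p : DualTotal F A, S.bivector.toFun p = L.dualBivector φ p) ∧
      (∀ p : DualTotal F A, S.field p = dualField φ p) := by
  have : Nontrivial F := Module.nontrivial_of_finrank_pos hrank
  exact ⟨JacobiStructure.lieAlgebroid (S := S) C1 C2, S.cocycle,
    JacobiStructure.isCocycle_cocycle C1 C2, JacobiStructure.bivector_eq_dualBivector C1 C2,
    JacobiStructure.field_eq_dualField C2⟩
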